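/- Let $m,n$ be positive integers. The Klein bottle $K$ is the quotient space of the rectangle $[0,m]\times[0,n]$ by the identifications $(0,y)\sim(m,y)$ for $y\in[0,n]$ and $(x,0)\sim(m-x,n)$ for $x\in[0,m]$; it is tiled by $mn$ unit squares, and the plane tiled by unit squares is its universal cover. Let $\mathcal P$ be the knight graph of the plane: its vertices are the points $(a,b)\in\mathbb Z^2$ (standing for the unit squares with centres $(a+\frac12,b+\frac12)$), and $(a,b)$ is joined to $(a+c,b+d)$ exactly when $\{|c|,|d|\}=\{1,2\}$. The knight pseudograph $\mathcal K_{m,n}$ is the quotient of $\mathcal P$ by the deck transformations of the universal cover of $K$, which are generated by $(a,b)\mapsto(a+m,b)$ and $(a,b)\mapsto(m-1-a,b+n)$. Thus its vertices are the $mn$ squares of $K$ and it has one edge for each distinct knight move between squares (loops and multiple edges may occur). Each vertex is sent to the centre of its square, and each edge to the image in $K$ of the line segment between the centres of the endpoints of a lift of the edge to $\mathcal P$. A knight's tour on $\mathcal K_{m,n}$ is a Hamiltonian cycle based at the vertex $(0,0)$: a closed walk that starts and ends at $(0,0)$, visits every vertex, leaves no vertex more than once, and repeats no edge (when $m=n=1$,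 the constant walk counts as a tour). A tour is nullhomotopic if the loop in $K$ to which it is sent represents the identity of $\pi_1\bigl(K,(\frac12,\frac12)\bigr)$. Theorem. The pseudograph $\mathcal K_{m,n}$ has a nullhomotopic knight's tour if and only if neither of the following holds: (1) both $m$ and $n$ are odd and at least one of $m$ and $n$ is greater than $1$; (2) both $m$ and $n$ are less than or equal to $2$ and at least one of $m$ and $n$ is greater than $1$. -/

import Mathlib

/-!
Knight's tours on the `m × n` Klein bottle board: the surface, its covering by the plane, the knight
pseudograph, its map to the surface, and nullhomotopic closed tours. The board sizes are positive
natural numbers (`[NeZero m] [NeZero n]`).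
-/

namespace KleinKnight

/-! ### The Klein bottle -/

/-- The rectangle `[0,m] × [0,n]`. -/
abbrev Rect (m n : ℕ) : Type :=
  {p : ℝ × ℝ // p.1 ∈ Set.Icc (0 : ℝ) m ∧ p.2 ∈ Set.Icc (0 : ℝ) n}

/-- The identifications on the boundary of the rectangle: `(0,y)` with `(m,y)`, and `(x,0)` with
`(m-x,n)`. -/
inductive Glue (m n : ℕ) : Rect m n → Rect m n → Prop
  | side (p q : Rect m n) (hp : p.1.1 = 0) (hq : q.1.1 = m) (h : q.1.2 = p.1.2) : Glue m n p q
  | twist (p q : Rect m n) (hp : p.1.2 = 0) (hq : q.1.2 = n) (h : q.1.1 = m - p.1.1) : Glue m n p q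

/-- The Klein bottle of dimensions `m × n`: the quotient space of the rectangle. -/
abbrev Klein (m n : ℕ) : Type := Quot (Glue m n)

/-- The real number `(-1)^k x`. -/
noncomputable def flipR (k : ℤ) (x : ℝ) : ℝ := if Even k then x else -x

/-- The remainder of `x` modulo `r`, in `[0,r)` when `0 < r`. -/
noncomputable def modR (x r : ℝ) : ℝ := x - r * ⌊x / r⌋

theorem modR_mem {r : ℝ} (hr : 0 < r) (x : ℝ) : modR x r ∈ Set.Icc 0 r := by
  unfold modR
  have h1 := Int.floor_le (x / r)
  have h2 := (Int.lt_floor_add_one (x / r)).le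
  have e : x = r * (x / r) := by field_simp
  constructor <;> nlinarith

theorem cast_pos' (m : ℕ) [NeZero m] : (0 : ℝ) < m := Nat.cast_pos.mpr (NeZero.pos m)

/-- The point `((-1)^(y div n) x mod m, y mod n)` of the rectangle. -/
noncomputable def reduceR (m n : ℕ) [NeZero m] [NeZero n] (p : ℝ × ℝ) : Rect m n :=
  ⟨(modR (flipR ⌊p.2 / n⌋ p.1) m, modR p.2 n),
    modR_mem (cast_pos' m) _, modR_mem (cast_pos' n) _⟩

/-- The universal covering map from the plane to the Klein bottle. -/
noncomputable def cover (m n : ℕ) [NeZero m] [NeZero n] (p : ℝ × ℝ) : Klein m n :=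
  Quot.mk _ (reduceR m n p)

theorem flipR_add_one (k : ℤ) (x : ℝ) : flipR (k + 1) x = -flipR k x := by
  unfold flipR
  by_cases h : Even k <;> simp [h]

theorem floor_eq_or {r y : ℝ} (hr : 0 < r) {j : ℤ} (h : y - r * j ∈ Set.Icc 0 r) :
    ⌊y / r⌋ = j ∨ (⌊y / r⌋ = j + 1 ∧ y - r * j = r) := by
  rcases h.2.lt_or_eq with h2 | h2
  · left
    rw [Int.floor_eq_iff]
    constructor
    · rw [le_div_iff₀ hr]; linarith [h.1, mul_comm r (j : ℝ)]
    · rw [div_lt_iff₀ hr]; linarith [mul_comm r (j : ℝ)]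
  · right
    refine ⟨?_, h2⟩
    have : y / r = ((j + 1 : ℤ) : ℝ) := by
      push_cast
      field_simp
      linarith
    rw [this, Int.floor_intCast]

/-- On each closed cell of the plane, the covering map is an isometry onto the rectangle followed by
the quotient map. -/
theorem cover_eq (m n : ℕ) [NeZero m] [NeZero n] (p : ℝ × ℝ) (i j : ℤ) (q : Rect m n)
    (h1 : q.1.1 = flipR j p.1 - m * i) (h2 : q.1.2 = p.2 - n * j) :
    cover m n p = Quot.mk _ q := by
  have key : ∀ (i : ℤ) (q : Rect m n), q.1.1 = flipR ⌊p.2 / n⌋ p.1 - m * i →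
      q.1.2 = p.2 - n * ⌊p.2 / n⌋ → cover m n p = Quot.mk _ q := by
    intro i q h1 h2
    have hq := q.2.1
    rw [h1] at hq
    rcases floor_eq_or (cast_pos' m) hq with h | ⟨h, h'⟩
    · refine congrArg _ (Subtype.ext (Prod.ext ?_ ?_))
      · simp [reduceR, modR, h, h1]
      · simp [reduceR, modR, h2]
    · refine Quot.sound (Glue.side _ _ ?_ ?_ ?_)
      · simp only [reduceR, modR, h]; push_cast; linarith
      · rw [h1, h']
      · simp [reduceR, modR, h2]
  have hq := q.2.2
  rw [h2] at hq
  rcases floor_eq_or (cast_pos' n) hq with h | ⟨h, h'⟩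
  · exact key i q (by rw [h, h1]) (by rw [h, h2])
  · have hx := q.2.1
    let q' : Rect m n := ⟨(m - q.1.1, 0), ⟨⟨by linarith [hx.2], by linarith [hx.1]⟩,
      ⟨le_refl _, (cast_pos' n).le⟩⟩⟩
    have e : Quot.mk (Glue m n) q' = Quot.mk _ q :=
      Quot.sound (Glue.twist _ _ rfl (by rw [h2, h']) (by simp [q']))
    rw [← e]
    refine key (-i - 1) q' ?_ ?_
    · simp only [q', h, flipR_add_one, h1]; push_cast; ring
    · simp only [q', h]; push_cast; linarith

theorem continuous_flipR (k : ℤ) : Continuous (flipR k) := by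
  unfold flipR
  by_cases h : Even k <;> simp only [h, if_true, if_false] <;> fun_prop

theorem abs_flipR (k : ℤ) (x : ℝ) : |flipR k x| = |x| := by
  unfold flipR; split_ifs <;> simp

/-- The closed cell of the plane that the integers `i`, `j` index. -/
def cell (m n : ℕ) (ij : ℤ × ℤ) : Set (ℝ × ℝ) :=
  {p | flipR ij.2 p.1 - m * ij.1 ∈ Set.Icc (0 : ℝ) m ∧ p.2 - n * ij.2 ∈ Set.Icc (0 : ℝ) n}

theorem continuous_cover (m n : ℕ) [NeZero m] [NeZero n] : Continuous (cover m n) := by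
  have hm := cast_pos' m
  have hn := cast_pos' n
  have hc1 : ∀ ij : ℤ × ℤ, Continuous fun p : ℝ × ℝ => flipR ij.2 p.1 - m * ij.1 := fun ij =>
    ((continuous_flipR _).comp continuous_fst).sub continuous_const
  have hc2 : ∀ ij : ℤ × ℤ, Continuous fun p : ℝ × ℝ => p.2 - (n : ℝ) * ij.2 := fun ij =>
    continuous_snd.sub continuous_const
  refine LocallyFinite.continuous (f := cell m n) ?_ ?_ ?_ ?_
  · intro p
    refine ⟨Metric.ball p 1, Metric.ball_mem_nhds _ one_pos, ?_⟩
    have hfin : ∀ r c : ℝ, 0 < r → {i : ℤ | |r * i| ≤ c}.Finite := by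
      intro r c hr
      refine (Set.finite_Icc (-⌈c / r⌉) ⌈c / r⌉).subset fun i hi => ?_
      have h := abs_le.mp (show |r * (i : ℝ)| ≤ c from hi)
      have h1 : (i : ℝ) ≤ c / r := by rw [le_div_iff₀ hr]; linarith [mul_comm r (i : ℝ)]
      have h2 : ((-i : ℤ) : ℝ) ≤ c / r := by
        push_cast; rw [le_div_iff₀ hr]; linarith [mul_comm r (i : ℝ)]
      have h3 : i ≤ ⌈c / r⌉ := by exact_mod_cast h1.trans (Int.le_ceil _)
      have h4 : -i ≤ ⌈c / r⌉ := by exact_mod_cast h2.trans (Int.le_ceil _)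
      exact ⟨by linarith, h3⟩
    refine ((hfin m (|p.1| + 1 + m) hm).prod (hfin n (|p.2| + 1 + n) hn)).subset ?_
    rintro ⟨i, j⟩ ⟨q, ⟨hq1, hq2⟩, hq⟩
    have hd := Metric.mem_ball.mp hq
    rw [Prod.dist_eq, max_lt_iff, Real.dist_eq, Real.dist_eq] at hd
    have a1 : |q.1| ≤ |p.1| + 1 := by linarith [abs_sub_abs_le_abs_sub q.1 p.1, hd.1]
    have a2 : |q.2| ≤ |p.2| + 1 := by linarith [abs_sub_abs_le_abs_sub q.2 p.2, hd.2]
    rw [← abs_flipR j] at a1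
    have b1 := abs_le.mp a1
    have b2 := abs_le.mp a2
    refine ⟨show |(m : ℝ) * (i : ℝ)| ≤ _ from abs_le.mpr ?_,
      show |(n : ℝ) * (j : ℝ)| ≤ _ from abs_le.mpr ?_⟩
    · exact ⟨by linarith [hq1.1, hq1.2], by linarith [hq1.1, hq1.2]⟩
    · exact ⟨by linarith [hq2.1, hq2.2], by linarith [hq2.1, hq2.2]⟩
  · refine Set.eq_univ_of_forall fun p => Set.mem_iUnion.mpr
      ⟨(⌊flipR ⌊p.2 / n⌋ p.1 / m⌋, ⌊p.2 / n⌋), ?_⟩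
    exact ⟨modR_mem hm _, modR_mem hn _⟩
  · exact fun ij => (isClosed_Icc.preimage (hc1 ij)).inter (isClosed_Icc.preimage (hc2 ij))
  · intro ij
    rw [continuousOn_iff_continuous_domRestrict]
    have e : (cell m n ij).domRestrict (cover m n) = fun p : cell m n ij =>
        Quot.mk (Glue m n) ⟨(flipR ij.2 p.1.1 - m * ij.1, p.1.2 - n * ij.2), p.2.1, p.2.2⟩ := by
      funext p
      exact cover_eq m n p.1 ij.1 ij.2 _ rfl rfl
    rw [e]
    refine continuous_quot_mk.comp (Continuous.subtype_mk ?_ _)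
    exact ((hc1 ij).comp continuous_subtype_val).prodMk ((hc2 ij).comp continuous_subtype_val)

/-! ### The knight pseudograph -/

/-- The vertices `(a,b)`, `0 ≤ a < m`, `0 ≤ b < n`; the vertex `(a,b)` is the unit square with lower
left corner `(a,b)`. -/
abbrev Vertex (m n : ℕ) : Type := Fin m × Fin n

/-- The integer point of the plane that the vertex is. -/
def Vertex.toPlane {m n : ℕ} (v : Vertex m n) : ℤ × ℤ := (v.1, v.2)

/-- `a mod m` as an element of `{0, …, m-1}`. -/
def modZ (m : ℕ) [NeZero m] (a : ℤ) : Fin m :=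
  ⟨(a % m).toNat, by
    have h := Int.emod_lt_of_pos a (Int.natCast_pos.mpr (NeZero.pos m))
    have h' := Int.emod_nonneg a (Int.natCast_ne_zero.mpr (NeZero.ne m))
    omega⟩

/-- The vertex of the board under the unit square of the plane with lower left corner `(a,b)`. The
reflection `x ↦ -x` carries the column `a ≤ x ≤ a + 1` to the column with left side `-1 - a`. -/
def proj (m n : ℕ) [NeZero m] [NeZero n] (p : ℤ × ℤ) : Vertex m n :=
  (modZ m (if Even (p.2 / (n : ℤ)) then p.1 else -1 - p.1), modZ n p.2)

/-- The eight displacements of a knight. -/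
abbrev Move : Type := {c : ℤ × ℤ // (|c.1| = 1 ∧ |c.2| = 2) ∨ (|c.1| = 2 ∧ |c.2| = 1)}

/-- The vertex that the move `c` leads to from `v`: move in the plane, then project. -/
def target {m n : ℕ} [NeZero m] [NeZero n] (v : Vertex m n) (c : Move) : Vertex m n :=
  proj m n (v.toPlane + c.1)

/-- The displacement that undoes the move `c` from `v`, as it reads at the vertex `target v c`: it is
`-c`, reflected if the move crosses the twisted side. -/
def back {m n : ℕ} [NeZero m] [NeZero n] (v : Vertex m n) (c : Move) : Move :=
  ⟨(if Even ((v.toPlane + c.1).2 / (n : ℤ)) then -c.1.1 else c.1.1, -c.1.2), by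
    have h := c.2
    split_ifs <;> simpa only [abs_neg] using h⟩

/-- The edge of the pseudograph that the move `c` from `v` traverses: a move and the move that undoes
it are the same edge, and no other moves are identified. -/
def edge {m n : ℕ} [NeZero m] [NeZero n] (v : Vertex m n) (c : Move) : Sym2 (Vertex m n × Move) :=
  s((v, c), (target v c, back v c))

/-- Walks in the pseudograph, as successions of directed edges. -/
inductive Walk (m n : ℕ) [NeZero m] [NeZero n] : Vertex m n → Vertex m n → Type
  | nil (v : Vertex m n) : Walk m n v v
  | cons (u : Vertex m n) {v : Vertex m n} (c : Move) (w : Walk m n (target u c) v) : Walk m n u v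

namespace Walk

variable {m n : ℕ} [NeZero m] [NeZero n]

/-- The list of the vertices from which the walk makes a move (all but the last one). -/
def starts {u v : Vertex m n} : Walk m n u v → List (Vertex m n)
  | nil _ => []
  | cons u _ w => u :: w.starts

/-- The list of the traversed edges. -/
def edges {u v : Vertex m n} : Walk m n u v → List (Sym2 (Vertex m n × Move))
  | nil _ => []
  | cons u c w => edge u c :: w.edges

/-- A (closed) knight's tour, that is, a Hamiltonian cycle: a closed walk that repeats no edge, leaves
no vertex twice, and visits every vertex. On the board with a single square the constant walk is a
tour. -/
structure IsTour {v : Vertex m n} (w : Walk m n v v) : Prop where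
  edges_nodup : w.edges.Nodup
  starts_nodup : w.starts.Nodup
  visits : ∀ u : Vertex m n, u = v ∨ u ∈ w.starts

end Walk

/-! ### The map from the pseudograph to the surface -/

/-- The centre of the unit square with lower left corner `p`. -/
noncomputable def centre (p : ℤ × ℤ) : ℝ × ℝ := (p.1 + 1 / 2, p.2 + 1 / 2)

/-- The point of the Klein bottle that a vertex is sent to. -/
noncomputable def point {m n : ℕ} [NeZero m] [NeZero n] (v : Vertex m n) : Klein m n :=
  cover m n (centre v.toPlane)

theorem modZ_cast (m : ℕ) [NeZero m] (a : ℤ) : ((modZ m a : ℕ) : ℤ) = a - m * (a / m) := by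
  have h' := Int.emod_nonneg a (Int.natCast_ne_zero.mpr (NeZero.ne m))
  have e := Int.emod_def a m
  simp only [modZ]
  omega

theorem modZ_castR (m : ℕ) [NeZero m] (a : ℤ) :
    (((modZ m a : ℕ) : ℤ) : ℝ) = a - m * ((a / m : ℤ) : ℝ) := by
  rw [modZ_cast]; push_cast; ring

theorem centre_mem {m n : ℕ} (v : Vertex m n) :
    (centre v.toPlane).1 ∈ Set.Icc (0 : ℝ) m ∧ (centre v.toPlane).2 ∈ Set.Icc (0 : ℝ) n := by
  have h1 : ((v.1 : ℕ) : ℝ) + 1 ≤ m := by exact_mod_cast v.1.2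
  have h2 : ((v.2 : ℕ) : ℝ) + 1 ≤ n := by exact_mod_cast v.2.2
  have h3 : (0 : ℝ) ≤ ((v.1 : ℕ) : ℝ) := Nat.cast_nonneg _
  have h4 : (0 : ℝ) ≤ ((v.2 : ℕ) : ℝ) := Nat.cast_nonneg _
  simp only [centre, Vertex.toPlane, Set.mem_Icc, Int.cast_natCast]
  refine ⟨⟨?_, ?_⟩, ?_, ?_⟩ <;> linarith

/-- The square of centres commutes: projecting a square of the plane to the board and then to the
surface is the covering map. -/
theorem cover_centre (m n : ℕ) [NeZero m] [NeZero n] (p : ℤ × ℤ) :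
    cover m n (centre p) = point (proj m n p) := by
  let q : Rect m n := ⟨_, centre_mem (proj m n p)⟩
  have e1 : point (proj m n p) = Quot.mk _ q :=
    cover_eq m n _ 0 0 q (by simp [q, flipR]) (by simp [q])
  rw [e1]
  refine cover_eq m n _ ((if Even (p.2 / (n : ℤ)) then p.1 else -1 - p.1) / (m : ℤ))
    (p.2 / (n : ℤ)) q ?_ ?_
  · simp only [q, centre, Vertex.toPlane, proj, modZ_castR, flipR]
    split_ifs <;> push_cast <;> ring
  · simp only [q, centre, Vertex.toPlane, proj, modZ_castR]
    ring

/-- The image of the directed edge given by the move `c` from `v`: the image under the covering map of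
the straight line segment between the centres of the squares `v` and `v + c` of the plane. -/
noncomputable def edgePath {m n : ℕ} [NeZero m] [NeZero n] (v : Vertex m n) (c : Move) :
    Path (point v) (point (target v c)) :=
  ((Path.segment (centre v.toPlane) (centre (v.toPlane + c.1))).map (continuous_cover m n)).cast
    rfl (cover_centre m n _).symm

/-- The image of a walk in the Klein bottle. -/
noncomputable def Walk.toPath {m n : ℕ} [NeZero m] [NeZero n] {u v : Vertex m n} :
    Walk m n u v → Path (point u) (point v)
  | .nil v => Path.refl (point v)
  | .cons u c w => (edgePath u c).trans w.toPath

/-- A closed walk is nullhomotopic if its class in the fundamental group of the Klein bottle is the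
identity. -/
def Walk.IsNullhomotopic {m n : ℕ} [NeZero m] [NeZero n] {v : Vertex m n} (w : Walk m n v v) :
    Prop :=
  FundamentalGroup.fromPath (Path.Homotopic.Quotient.mk w.toPath) = 1

/-- The base vertex `(0,0)`. -/
def base (m n : ℕ) [NeZero m] [NeZero n] : Vertex m n := (0, 0)

/-- The Klein bottle knight pseudograph has a nullhomotopic knight's tour. -/
def HasNullhomotopicTour (m n : ℕ) [NeZero m] [NeZero n] : Prop :=
  ∃ w : Walk m n (base m n) (base m n), w.IsTour ∧ w.IsNullhomotopic

end KleinKnight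

namespace KleinKnight

/-! ### Deck transformations -/

/-! A walk on the board lifts to a succession of knight's moves in the plane, and a closed walk is
nullhomotopic exactly if its lift is closed (`Walk.isNullhomotopic_iff_liftEnd`). On a board with
more than one square, a nullhomotopic tour is thus a closed knight's circuit in the plane that meets
each orbit of squares once and repeats no edge of the quotient.

Obstructions. A knight's move changes the parity of the coordinate sum, so a closed lift has evenly
many moves and `m * n` cannot be odd unless it is 1. With two squares, a closed lift retraces its
first edge. For the 2 × 2 board, the closed circuits of four moves are checked.

Constructions. With at least three squares, distinct vertices already make the edges distinct, so it
suffices to exhibit a closed list of squares (`hasNullhomotopicTour_of_isLoop`). Two devices give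
infinite families. Nested insertions (`nest`) widen a tour: a path from `a` to `b` is translated and
enclosed in a longer path with the same ends. Bands are closed tours of horizontal strips with a
prescribed kind of move at the top and at the bottom; stacked bands are joined by exchanging two
parallel moves for two others (`Band.append`). For even `m`, bands of 3, 5 and 7 rows give every
height `n ≥ 3` except 4. For odd `m`, bands of 4 and 6 rows whose squares lie two columns apart give
every even `n ≥ 4`, since 2 is invertible modulo `m`. For `n = 4` and even `m`, two such bands of
half the width are used, one of them read through the twist. Heights 1 and 2 have explicit nested
families that cross the twisted side. -/

theorem flipR_add (j k : ℤ) (x : ℝ) : flipR (j + k) x = flipR j (flipR k x) := by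
  unfold flipR
  by_cases hj : Even j <;> by_cases hk : Even k <;> simp [hj, hk, Int.even_add]

theorem flipR_map_add (j : ℤ) (x y : ℝ) : flipR j (x + y) = flipR j x + flipR j y := by
  unfold flipR; split_ifs <;> ring

theorem flipR_mul_intCast (j : ℤ) (r : ℝ) (i : ℤ) : ∃ k : ℤ, flipR j (r * i) = r * k := by
  unfold flipR
  split_ifs
  · exact ⟨i, rfl⟩
  · exact ⟨-i, by push_cast; ring⟩

theorem flipR_zero (x : ℝ) : flipR 0 x = x := by simp [flipR]

/-- The deck transformation of the plane with indices `i`, `j`. -/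
noncomputable def deck (m n : ℕ) (i j : ℤ) (p : ℝ × ℝ) : ℝ × ℝ :=
  (flipR j p.1 + m * i, p.2 + n * j)

theorem continuous_deck (m n : ℕ) (i j : ℤ) : Continuous (deck m n i j) := by
  have h : Continuous fun p : ℝ × ℝ => flipR j p.1 := (continuous_flipR j).comp continuous_fst
  exact (h.add continuous_const).prodMk (continuous_snd.add continuous_const)

theorem cover_deck (m n : ℕ) [NeZero m] [NeZero n] (i j : ℤ) (p : ℝ × ℝ) :
    cover m n (deck m n i j p) = cover m n p := by
  have hm := (cast_pos' m).ne'
  have hn := (cast_pos' n).ne'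
  have hf : ⌊(p.2 + n * j) / n⌋ = ⌊p.2 / n⌋ + j := by
    rw [add_div, mul_div_cancel_left₀ _ hn, Int.floor_add_intCast]
  unfold cover
  congr 1
  refine Subtype.ext (Prod.ext ?_ ?_)
  · simp only [reduceR, deck, hf]
    rw [flipR_map_add]
    obtain ⟨k, hk⟩ := flipR_mul_intCast (⌊p.2 / n⌋ + j) m i
    have e : flipR (⌊p.2 / n⌋ + j) (flipR j p.1) = flipR ⌊p.2 / n⌋ p.1 := by
      rw [flipR_add]
      congr 1
      rw [← flipR_add]
      simp [flipR]
    rw [hk, e, modR, modR, add_div, mul_div_cancel_left₀ _ hm, Int.floor_add_intCast]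
    push_cast
    ring
  · simp only [reduceR, deck, modR, hf]
    push_cast
    ring

/-- The group of the deck transformations. -/
def deckGroup (m n : ℕ) : Subgroup (Equiv.Perm (ℝ × ℝ)) where
  carrier := {f | ∃ i j : ℤ, ∀ p, f p = deck m n i j p}
  one_mem' := ⟨0, 0, fun p => by simp [deck, flipR_zero]⟩
  mul_mem' := by
    rintro f g ⟨i, j, hf⟩ ⟨i', j', hg⟩
    obtain ⟨k, hk⟩ := flipR_mul_intCast j m i'
    refine ⟨i + k, j + j', fun p => ?_⟩
    rw [Equiv.Perm.mul_apply, hf, hg]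
    simp only [deck, flipR_map_add, hk, flipR_add]
    refine Prod.ext ?_ ?_ <;> push_cast <;> ring
  inv_mem' := by
    rintro f ⟨i, j, hf⟩
    obtain ⟨k, hk⟩ := flipR_mul_intCast (-j) m i
    refine ⟨-k, -j, fun p => ?_⟩
    rw [Equiv.Perm.inv_eq_iff_eq, hf]
    refine Prod.ext ?_ ?_
    · simp only [deck, flipR_map_add, ← flipR_add]
      obtain ⟨k', hk'⟩ := flipR_mul_intCast j m (-k)
      have e := congrArg (flipR j) hk
      rw [← flipR_add, add_neg_cancel, flipR_zero] at e
      have e2 : flipR j ((m : ℝ) * ((-k : ℤ) : ℝ)) = - flipR j ((m : ℝ) * k) := by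
        unfold flipR; split_ifs <;> push_cast <;> ring
      rw [add_neg_cancel, flipR_zero, e2, ← e]
      ring
    · simp only [deck]; push_cast; ring

/-- A deck transformation, as an element of the group. -/
theorem exists_deckGroup (m n : ℕ) (i j : ℤ) :
    ∃ g : deckGroup m n, ∀ p : ℝ × ℝ, g • p = deck m n i j p := by
  obtain ⟨k, hk⟩ := flipR_mul_intCast (-j) m i
  have e2 : ∀ l, flipR l (-((m : ℝ) * i)) = - flipR l ((m : ℝ) * i) := fun l => by
    unfold flipR; split_ifs <;> ring
  let f : Equiv.Perm (ℝ × ℝ) :=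
    { toFun := deck m n i j
      invFun := fun p => (flipR (-j) (p.1 + -(m * i)), p.2 - n * j)
      left_inv := fun p => by
        refine Prod.ext ?_ ?_
        · simp only [deck, add_neg_cancel_right, ← flipR_add, neg_add_cancel, flipR_zero]
        · simp [deck]
      right_inv := fun p => by
        refine Prod.ext ?_ ?_
        · simp only [deck, ← flipR_add, add_neg_cancel, flipR_zero]; ring
        · simp [deck] }
  exact ⟨⟨f, i, j, fun _ => rfl⟩, fun _ => rfl⟩

/-! ### The orbit space and its covering by the plane -/

/-- The orbit space of the deck transformations. -/
abbrev OrbitSpace (m n : ℕ) : Type := Quotient (MulAction.orbitRel (deckGroup m n) (ℝ × ℝ))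

theorem orbit_mk_deck (m n : ℕ) (i j : ℤ) (p : ℝ × ℝ) :
    (Quotient.mk _ (deck m n i j p) : OrbitSpace m n) = Quotient.mk _ p := by
  obtain ⟨g, hg⟩ := exists_deckGroup m n i j
  refine Quotient.sound ?_
  rw [← hg]
  exact MulAction.mem_orbit _ _

/-- The map from the Klein bottle to the orbit space. -/
def toOrbit (m n : ℕ) : Klein m n → OrbitSpace m n :=
  Quot.lift (fun p => Quotient.mk _ p.1) (by
    rintro p q (⟨hp, hq, h⟩ | ⟨hp, hq, h⟩)
    · rw [← orbit_mk_deck m n 1 0 p.1]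
      congr 1
      refine Prod.ext ?_ ?_
      · simp [deck, flipR_zero, hp, hq]
      · simp [deck, h]
    · rw [← orbit_mk_deck m n 1 1 p.1]
      congr 1
      refine Prod.ext ?_ ?_
      · simp [deck, flipR, h]; ring
      · simp [deck, hp, hq])

theorem continuous_toOrbit (m n : ℕ) : Continuous (toOrbit m n) :=
  continuous_quot_lift _ (continuous_quotient_mk'.comp continuous_subtype_val)

/-- This factorisation replaces a homeomorphism between the Klein bottle and the orbit space:
homotopies are pushed forward along `toOrbit` and lifted from the orbit space. -/
theorem toOrbit_cover (m n : ℕ) [NeZero m] [NeZero n] (p : ℝ × ℝ) :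
    toOrbit m n (cover m n p) = Quotient.mk _ p := by
  change (Quotient.mk _ (reduceR m n p).1 : OrbitSpace m n) = _
  obtain ⟨k, hk⟩ := flipR_mul_intCast (-⌊p.2 / n⌋) m ⌊flipR ⌊p.2 / n⌋ p.1 / m⌋
  rw [← orbit_mk_deck m n (-⌊flipR ⌊p.2 / n⌋ p.1 / m⌋) (-⌊p.2 / n⌋) p]
  congr 1
  have : flipR (-⌊p.2 / n⌋) p.1 = flipR ⌊p.2 / n⌋ p.1 := by simp [flipR]
  refine Prod.ext ?_ ?_
  · simp only [reduceR, modR, deck, this]; push_cast; ring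
  · simp only [reduceR, modR, deck]; push_cast; ring

/-- A deck transformation that moves some point by less than 1 is the identity: its vertical
displacement `n * j` forces `j = 0`, and then the horizontal one is `m * i`. Balls of radius 1/2 are
therefore evenly covered. -/
theorem isQuotientCoveringMap_orbit (m n : ℕ) [NeZero m] [NeZero n] :
    IsQuotientCoveringMap (Quotient.mk (MulAction.orbitRel (deckGroup m n) (ℝ × ℝ)))
      (deckGroup m n) where
  __ := isQuotientMap_quotient_mk'
  continuous_const_smul := by
    rintro ⟨g, i, j, hg⟩
    have : (fun p : ℝ × ℝ => (⟨g, i, j, hg⟩ : deckGroup m n) • p) = deck m n i j := funext hg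
    rw [this]
    exact continuous_deck m n i j
  apply_eq_iff_mem_orbit := Quotient.eq''
  disjoint e := by
    refine ⟨Metric.ball e (1 / 2), Metric.ball_mem_nhds _ (by norm_num), ?_⟩
    rintro ⟨g, i, j, hg⟩ ⟨_, ⟨q, hq, rfl⟩, hq'⟩
    have h1 := Metric.mem_ball.mp hq
    have h2 := Metric.mem_ball.mp hq'
    have hd : dist (deck m n i j q) q < 1 := by
      have h2' : dist (deck m n i j q) e < 1 / 2 := by rw [← hg]; exact h2
      linarith [dist_triangle_right (deck m n i j q) q e]
    rw [Prod.dist_eq, max_lt_iff, Real.dist_eq, Real.dist_eq] at hd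
    have key : ∀ (r : ℕ) (k : ℤ), r ≠ 0 → |(r : ℝ) * k| < 1 → k = 0 := by
      intro r k hr h
      by_contra hk
      have h1 : (1 : ℝ) ≤ r := by exact_mod_cast Nat.one_le_iff_ne_zero.mpr hr
      have h2 : (1 : ℝ) ≤ |(k : ℝ)| := by exact_mod_cast Int.one_le_abs hk
      rw [abs_mul, Nat.abs_cast] at h
      nlinarith
    have hj : j = 0 := key n j (NeZero.ne n) (by simpa [deck] using hd.2)
    subst hj
    have hi : i = 0 := key m i (NeZero.ne m) (by simpa [deck, flipR_zero] using hd.1)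
    subst hi
    refine Subtype.ext (Equiv.ext fun p => ?_)
    rw [hg]
    simp [deck, flipR_zero]

/-! ### Nullhomotopic loops and closed lifts -/

/-- A path of the plane whose image in the Klein bottle is a nullhomotopic loop is closed. -/
theorem eq_of_nullhomotopic {m n : ℕ} [NeZero m] [NeZero n] {x y : ℝ × ℝ} (γ : Path x y)
    {z : Klein m n} (δ : Path z z) (h : ∀ t, δ t = cover m n (γ t))
    (hδ : δ.Homotopic (Path.refl z)) : y = x := by
  have cov := (isQuotientCoveringMap_orbit m n).isCoveringMap
  have h0 : toOrbit m n z = Quotient.mk _ x := by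
    rw [← toOrbit_cover, ← δ.source, h, γ.source]
  have h1 := Path.Homotopic.map hδ ⟨toOrbit m n, continuous_toOrbit m n⟩
  have e := cov.liftPath_apply_one_eq_of_homotopicRel h1 x (by simpa using h0) (by simpa using h0)
  -- By uniqueness of lifts, `γ` and the constant path are the lifts from `x` of the two homotopic
  -- loops, so they end at the same point.
  have e1 : (γ : C(unitInterval, ℝ × ℝ)) = cov.liftPath
      (Path.map δ (continuous_toOrbit m n)).toContinuousMap x (by simpa using h0) := by
    rw [cov.eq_liftPath_iff']
    refine ⟨funext fun t => ?_, by simp⟩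
    simp [h, toOrbit_cover]
  have e2 : ContinuousMap.const unitInterval x = cov.liftPath
      (Path.map (Path.refl z) (continuous_toOrbit m n)).toContinuousMap x (by simpa using h0) := by
    rw [cov.eq_liftPath_iff']
    refine ⟨funext fun t => ?_, by simp⟩
    simp [h0]
  have := (congrArg (fun f : C(unitInterval, ℝ × ℝ) => f 1) e1).trans
    (e.trans (congrArg (fun f : C(unitInterval, ℝ × ℝ) => f 1) e2).symm)
  simpa using this

/-- A loop of the plane has a nullhomotopic image in the Klein bottle. -/
theorem homotopic_refl_of_lift {m n : ℕ} [NeZero m] [NeZero n] {x : ℝ × ℝ} (γ : Path x x)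
    {z : Klein m n} (δ : Path z z) (h : ∀ t, δ t = cover m n (γ t)) :
    δ.Homotopic (Path.refl z) := by
  have h0 : z = cover m n x := by rw [← δ.source, h, γ.source]
  subst h0
  have h1 := Path.Homotopic.map (SimplyConnectedSpace.paths_homotopic γ (Path.refl x))
    ⟨cover m n, continuous_cover m n⟩
  have e1 : δ = γ.map (continuous_cover m n) := by ext t; simp [h]
  rw [e1]
  convert! h1 using 1

theorem Walk.isNullhomotopic_iff {m n : ℕ} [NeZero m] [NeZero n] {v : Vertex m n}
    (w : Walk m n v v) : w.IsNullhomotopic ↔ w.toPath.Homotopic (Path.refl (point v)) :=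
  FundamentalGroupoid.fromPath_eq_iff_homotopic w.toPath (Path.refl (point v))

/-! ### Lifting walks to the plane -/

/-- The deck transformation with indices `i`, `j`, on the unit squares of the plane. -/
def deckZ (m n : ℕ) (i j : ℤ) (p : ℤ × ℤ) : ℤ × ℤ :=
  ((if Even j then p.1 else -1 - p.1) + m * i, p.2 + n * j)

theorem centre_deckZ (m n : ℕ) (i j : ℤ) (p : ℤ × ℤ) :
    centre (deckZ m n i j p) = deck m n i j (centre p) := by
  refine Prod.ext ?_ ?_
  · simp only [centre, deckZ, deck, flipR]
    split_ifs <;> push_cast <;> ring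
  · simp only [centre, deckZ, deck]; push_cast; ring

theorem modZ_add_mul (m : ℕ) [NeZero m] (a i : ℤ) : modZ m (a + m * i) = modZ m a := by
  simp [modZ]

theorem proj_deckZ (m n : ℕ) [NeZero m] [NeZero n] (i j : ℤ) (p : ℤ × ℤ) :
    proj m n (deckZ m n i j p) = proj m n p := by
  have hn : (n : ℤ) ≠ 0 := Int.natCast_ne_zero.mpr (NeZero.ne n)
  refine Prod.ext ?_ (modZ_add_mul n _ _)
  simp only [proj, deckZ, Int.add_mul_ediv_left _ _ hn, Int.even_add]
  by_cases h1 : Even j <;> by_cases h2 : Even (p.2 / (n : ℤ)) <;> simp only [h1, h2, if_true,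
    if_false, iff_true, iff_false, not_true]
  · exact modZ_add_mul m _ _
  · rw [← modZ_add_mul m (-1 - p.1) (-i)]; congr 1; ring
  · rw [← modZ_add_mul m p.1 (-i)]; congr 1; ring
  · exact modZ_add_mul m _ _

theorem exists_deckZ (m n : ℕ) [NeZero m] [NeZero n] (p : ℤ × ℤ) :
    ∃ i : ℤ, p = deckZ m n i (p.2 / n) (proj m n p).toPlane := by
  by_cases h : Even (p.2 / (n : ℤ))
  · refine ⟨p.1 / m, Prod.ext ?_ ?_⟩
    · simp only [deckZ, proj, Vertex.toPlane, h, if_true, modZ_cast]; ring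
    · simp only [deckZ, proj, Vertex.toPlane, modZ_cast]; ring
  · refine ⟨-((-1 - p.1) / m), Prod.ext ?_ ?_⟩
    · simp only [deckZ, proj, Vertex.toPlane, h, if_false, modZ_cast]; ring
    · simp only [deckZ, proj, Vertex.toPlane, modZ_cast]; ring

/-- The displacement of the plane at the square `p` that lifts the move `c`. -/
def liftMove (n : ℕ) (p c : ℤ × ℤ) : ℤ × ℤ :=
  (if Even (p.2 / (n : ℤ)) then c.1 else -c.1, c.2)

/-- A deck transformation acts on displacements by its linear part, which is the sign that
`liftMove` puts on the first coordinate. -/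
theorem add_liftMove (m n : ℕ) [NeZero m] [NeZero n] (p c : ℤ × ℤ) {i : ℤ}
    (h : p = deckZ m n i (p.2 / n) (proj m n p).toPlane) :
    p + liftMove n p c = deckZ m n i (p.2 / n) ((proj m n p).toPlane + c) := by
  have h1 := congrArg Prod.fst h
  have h2 := congrArg Prod.snd h
  refine Prod.ext ?_ ?_
  · simp only [deckZ, liftMove, Prod.fst_add] at h1 ⊢
    split_ifs with hp <;> simp only [hp, if_true, if_false] at h1 <;> linarith
  · simp only [deckZ, liftMove, Prod.snd_add] at h2 ⊢
    linarith

theorem proj_add_liftMove (m n : ℕ) [NeZero m] [NeZero n] (p : ℤ × ℤ) (c : Move) :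
    proj m n (p + liftMove n p c.1) = target (proj m n p) c := by
  obtain ⟨i, hi⟩ := exists_deckZ m n p
  rw [add_liftMove m n p c.1 hi, proj_deckZ, target]

theorem edgePath_eq_cover {m n : ℕ} [NeZero m] [NeZero n] (p : ℤ × ℤ) (c : Move)
    (t : unitInterval) : edgePath (proj m n p) c t =
      cover m n (Path.segment (centre p) (centre (p + liftMove n p c.1)) t) := by
  obtain ⟨i, hi⟩ := exists_deckZ m n p
  have hc : centre p = deck m n i (p.2 / n) (centre (proj m n p).toPlane) := by
    rw [← centre_deckZ, ← hi]
  -- Deck transformations are affine, so they respect the parametrisation of segments.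
  have e : Path.segment (deck m n i (p.2 / n) (centre (proj m n p).toPlane))
        (deck m n i (p.2 / n) (centre ((proj m n p).toPlane + c.1))) t =
      deck m n i (p.2 / n) (Path.segment (centre (proj m n p).toPlane)
        (centre ((proj m n p).toPlane + c.1)) t) := by
    simp only [Path.segment_apply, AffineMap.lineMap_apply_module]
    refine Prod.ext ?_ ?_
    · simp only [deck, flipR, Prod.fst_add, Prod.smul_fst, smul_eq_mul]
      split_ifs <;> ring
    · simp only [deck, Prod.snd_add, Prod.smul_snd, smul_eq_mul]; ring
  rw [add_liftMove m n p c.1 hi, centre_deckZ, hc, e, cover_deck]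
  rfl

/-- The last square of the lift of a walk that starts at the square `p`. -/
def Walk.liftEnd {m n : ℕ} [NeZero m] [NeZero n] : {u v : Vertex m n} → ℤ × ℤ → Walk m n u v → ℤ × ℤ
  | _, _, p, .nil _ => p
  | _, _, p, .cons _ c w => w.liftEnd (p + liftMove n p c.1)

theorem Walk.exists_lift {m n : ℕ} [NeZero m] [NeZero n] {u v : Vertex m n} (w : Walk m n u v) :
    ∀ p : ℤ × ℤ, proj m n p = u →
      ∃ γ : Path (centre p) (centre (w.liftEnd p)), ∀ t, w.toPath t = cover m n (γ t) := by
  induction w with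
  | nil v =>
    rintro p rfl
    exact ⟨Path.refl _, fun t => (cover_centre m n p).symm⟩
  | cons u c w ih =>
    rintro p rfl
    obtain ⟨γ, hγ⟩ := ih (p + liftMove n p c.1) (proj_add_liftMove m n p c)
    refine ⟨(Path.segment (centre p) (centre (p + liftMove n p c.1))).trans γ, fun t => ?_⟩
    change ((edgePath (proj m n p) c).trans w.toPath) t =
      cover m n (Path.trans (z := centre (w.liftEnd (p + liftMove n p c.1))) _ γ t)
    simp only [Path.trans_apply]
    split_ifs
    · exact edgePath_eq_cover p c _
    · exact hγ _

theorem centre_injective : Function.Injective centre := by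
  rintro ⟨a, b⟩ ⟨c, d⟩ h
  simpa [centre] using h

/-- A closed walk is nullhomotopic exactly if its lifts are closed. -/
theorem Walk.isNullhomotopic_iff_liftEnd {m n : ℕ} [NeZero m] [NeZero n] {v : Vertex m n}
    (w : Walk m n v v) (p : ℤ × ℤ) (hp : proj m n p = v) :
    w.IsNullhomotopic ↔ w.liftEnd p = p := by
  rw [w.isNullhomotopic_iff]
  obtain ⟨γ, hγ⟩ := w.exists_lift p hp
  constructor
  · exact fun h => centre_injective (eq_of_nullhomotopic γ _ hγ h)
  · intro h
    exact homotopic_refl_of_lift (γ.cast rfl (congrArg centre h.symm)) _ hγ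

/-! ### Tours from closed sequences of squares of the plane -/

/-- Two squares of the plane are a knight's move apart. -/
def Adj (p q : ℤ × ℤ) : Prop :=
  (|q.1 - p.1| = 1 ∧ |q.2 - p.2| = 2) ∨ (|q.1 - p.1| = 2 ∧ |q.2 - p.2| = 1)

instance : DecidableRel Adj := fun _ _ => inferInstanceAs (Decidable (_ ∨ _))

theorem Adj.symm {p q : ℤ × ℤ} (h : Adj p q) : Adj q p := by
  unfold Adj at *
  rwa [abs_sub_comm p.1, abs_sub_comm p.2]

theorem Adj.add {p q : ℤ × ℤ} (h : Adj p q) (t : ℤ × ℤ) : Adj (p + t) (q + t) := by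
  unfold Adj at *
  simpa only [Prod.fst_add, Prod.snd_add, add_sub_add_right_eq_sub] using h

theorem exists_move (n : ℕ) {p q : ℤ × ℤ} (h : Adj p q) : ∃ c : Move, p + liftMove n p c.1 = q := by
  -- The sign in `liftMove` depends on `p` alone, so `liftMove n p` is its own inverse.
  refine ⟨⟨liftMove n p (q - p), ?_⟩, ?_⟩
  · unfold liftMove
    change (|q.1 - p.1| = 1 ∧ |q.2 - p.2| = 2) ∨ (|q.1 - p.1| = 2 ∧ |q.2 - p.2| = 1) at h
    split_ifs
    · exact h
    · simpa only [abs_neg, Prod.fst_sub, Prod.snd_sub] using h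
  · unfold liftMove
    refine Prod.ext ?_ (by simp)
    simp only [Prod.fst_add]
    split_ifs <;> simp

theorem exists_walk (m n : ℕ) [NeZero m] [NeZero n] (l : List (ℤ × ℤ)) :
    ∀ (p q : ℤ × ℤ), List.IsChain Adj (p :: l ++ [q]) → ∀ u v : Vertex m n, u = proj m n p →
      v = proj m n q → ∃ w : Walk m n u v, w.starts = (p :: l).map (proj m n) ∧ w.liftEnd p = q := by
  induction l with
  | nil =>
    rintro p q h u v rfl rfl
    obtain ⟨c, rfl⟩ := exists_move n (by simpa using h : Adj p q)
    rw [proj_add_liftMove]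
    exact ⟨.cons _ c (.nil _), by simp [Walk.starts], by simp [Walk.liftEnd]⟩
  | cons r l ih =>
    rintro p q h u v rfl hv
    simp only [List.cons_append, List.isChain_cons_cons] at h
    obtain ⟨c, rfl⟩ := exists_move n h.1
    obtain ⟨w, hw1, hw2⟩ := ih _ q (by simpa using h.2) (target (proj m n p) c) v
      (proj_add_liftMove m n p c).symm hv
    exact ⟨.cons _ c w, by simp [Walk.starts, hw1], by simp [Walk.liftEnd, hw2]⟩

/-! ### Distinct vertices force distinct edges -/

namespace Walk

variable {m n : ℕ} [NeZero m] [NeZero n]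

theorem exists_of_mem_edges {u v : Vertex m n} (w : Walk m n u v) :
    ∀ e ∈ w.edges, ∃ x ∈ w.starts, ∃ c, e = edge x c ∧ (target x c ∈ w.starts ∨ target x c = v) := by
  induction w with
  | nil v => simp [edges]
  | cons u c w ih =>
    intro e he
    simp only [edges, List.mem_cons] at he
    rcases he with rfl | he
    · refine ⟨u, by simp [starts], c, rfl, ?_⟩
      cases w with
      | nil => exact Or.inr rfl
      | cons _ c' w' => exact Or.inl (by simp [starts])
    · obtain ⟨x, hx, c', rfl, h⟩ := ih e he
      refine ⟨x, by simp [starts, hx], c', rfl, ?_⟩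
      rcases h with h | h
      · exact Or.inl (by simp [starts, h])
      · exact Or.inr h

theorem eq_or_of_edge_eq {u x : Vertex m n} {c c' : Move} (h : edge u c = edge x c') :
    x = u ∨ (x = target u c ∧ target x c' = u) := by
  simp only [edge, Sym2.eq_iff, Prod.mk.injEq] at h
  rcases h with ⟨⟨h, -⟩, -⟩ | ⟨⟨h, -⟩, h', -⟩
  · exact Or.inl h.symm
  · exact Or.inr ⟨h'.symm, h.symm⟩

theorem edges_nodup_of_path {u v : Vertex m n} (w : Walk m n u v) :
    w.starts.Nodup → v ∉ w.starts → w.edges.Nodup := by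
  induction w with
  | nil v => simp [edges]
  | cons u c w ih =>
    intro hs hv
    simp only [starts, List.nodup_cons, List.mem_cons, not_or] at hs hv
    refine List.nodup_cons.mpr ⟨fun he => ?_, ih hs.2 hv.2⟩
    obtain ⟨x, hx, c', e, h⟩ := w.exists_of_mem_edges _ he
    rcases eq_or_of_edge_eq e with rfl | ⟨-, h'⟩
    · exact hs.1 hx
    · rw [h'] at h
      exact h.elim hs.1 fun h => hv.1 h.symm

theorem mem_starts {u v : Vertex m n} (w : Walk m n u v) (h : w.starts ≠ []) : u ∈ w.starts := by
  cases w with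
  | nil => exact absurd rfl h
  | cons _ c w => simp [starts]

/-- Another passage along the edge would have the same two ends. Only the first move of `w` could do
this without repeating a vertex, by returning to `u` at once, and then `w` would have a single
start. -/
theorem edge_notMem_edges {u t : Vertex m n} (w : Walk m n t u) {c : Move} (ht : target u c = t)
    (hu : u ∉ w.starts) (hs : w.starts.Nodup) (hl : 2 ≤ w.starts.length) :
    edge u c ∉ w.edges := by
  intro he
  cases w with
  | nil => simp [starts] at hl
  | cons _ c1 w =>
    simp only [starts, List.nodup_cons, List.mem_cons, not_or] at hs hu
    simp only [edges, List.mem_cons] at he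
    rcases he with he | he
    · rcases eq_or_of_edge_eq he with h | ⟨-, h⟩
      · exact hu.1 h.symm
      · simp only [starts, List.length_cons] at hl
        exact hu.2 ((congrArg (· ∈ w.starts) h).mp
          (w.mem_starts (List.ne_nil_of_length_pos (by omega))))
    · obtain ⟨x, hx, c', e, -⟩ := w.exists_of_mem_edges _ he
      rcases eq_or_of_edge_eq e with rfl | ⟨h, -⟩
      · exact hu.2 hx
      · rw [ht] at h
        exact hs.1 (h ▸ hx)

theorem edges_nodup_of_closed {v : Vertex m n} (w : Walk m n v v) (hs : w.starts.Nodup)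
    (hl : 3 ≤ w.starts.length) : w.edges.Nodup := by
  cases w with
  | nil => simp [edges]
  | cons _ c w =>
    simp only [starts, List.nodup_cons] at hs
    simp only [starts, List.length_cons] at hl
    exact List.nodup_cons.mpr ⟨w.edge_notMem_edges rfl hs.1 hs.2 (by omega),
      w.edges_nodup_of_path hs.2 hs.1⟩

end Walk

/-- A closed succession of knight's moves of the plane, as the list of its squares. -/
def IsLoop (l : List (ℤ × ℤ)) : Prop :=
  List.IsChain Adj l ∧ ∀ a ∈ l.getLast?, ∀ b ∈ l.head?, Adj a b

/-- Used to begin a loop at a square above the base vertex. -/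
theorem IsLoop.rotate {s t : List (ℤ × ℤ)} (h : IsLoop (s ++ t)) : IsLoop (t ++ s) := by
  rcases s.eq_nil_or_concat with rfl | ⟨s, a, rfl⟩
  · simpa using h
  rcases t.eq_nil_or_concat with rfl | ⟨t, b, rfl⟩
  · simpa using h
  obtain ⟨h1, h2⟩ := h
  rw [List.isChain_append] at h1
  refine ⟨List.isChain_append.mpr ⟨h1.2.1, h1.1, fun x hx y hy => h2 x ?_ y ?_⟩,
    fun x hx y hy => h1.2.2 x ?_ y ?_⟩
  · rw [List.getLast?_append, Option.mem_def.mp hx]; rfl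
  · rw [List.head?_append, Option.mem_def.mp hy]; rfl
  · rw [List.getLast?_append] at hx
    simpa using hx
  · rw [List.head?_append] at hy
    cases hh : (t ++ [b]).head? with
    | none => simp at hh
    | some z => simpa [hh] using hy

theorem hasNullhomotopicTour_of_isLoop (m n : ℕ) [NeZero m] [NeZero n] (l : List (ℤ × ℤ))
    (hl : IsLoop l) (hlen : l.length = m * n) (h3 : 3 ≤ m * n)
    (hproj : ∀ v : Vertex m n, ∃ p ∈ l, proj m n p = v) : HasNullhomotopicTour m n := by
  obtain ⟨p, hp, hpb⟩ := hproj (base m n)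
  obtain ⟨s, t, rfl⟩ := List.append_of_mem hp
  have hl' := hl.rotate
  rw [List.cons_append] at hl'
  have hc : List.IsChain Adj (p :: (t ++ s) ++ [p]) := by
    refine List.isChain_append.mpr ⟨hl'.1, by simp, fun x hx y hy => hl'.2 x hx y ?_⟩
    simpa using hy
  obtain ⟨w, hw1, hw2⟩ := exists_walk m n (t ++ s) p p hc (base m n) (base m n) hpb.symm hpb.symm
  have hlen' : w.starts.length = m * n := by
    rw [hw1, ← hlen]; simp; omega
  have hmem : ∀ u, u ∈ w.starts := by
    intro u
    obtain ⟨q, hq, rfl⟩ := hproj u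
    rw [hw1]
    refine List.mem_map_of_mem ?_
    simp only [List.mem_append, List.mem_cons] at hq ⊢
    tauto
  -- A list of length `m * n` that contains all `m * n` vertices has no repetition.
  have hnd : w.starts.Nodup := by
    rw [← Multiset.coe_nodup, ← Multiset.toFinset_card_eq_card_iff_nodup]
    have : (w.starts : Multiset (Vertex m n)).toFinset = Finset.univ :=
      Finset.eq_univ_of_forall fun u => by simpa using hmem u
    rw [this, Multiset.coe_card, hlen']
    simp
  exact ⟨w, ⟨w.edges_nodup_of_closed hnd (hlen' ▸ h3), hnd, fun u => Or.inr (hmem u)⟩,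
    (w.isNullhomotopic_iff_liftEnd p hpb).mpr hw2⟩

/-! ### Boards without nullhomotopic tours -/

theorem proj_zero (m n : ℕ) [NeZero m] [NeZero n] : proj m n (0, 0) = base m n := by
  refine Prod.ext (Fin.ext ?_) (Fin.ext ?_) <;> simp [proj, modZ, base]

/-- The eight displacements, as a list. -/
def moveList : List (ℤ × ℤ) :=
  [(1, 2), (1, -2), (-1, 2), (-1, -2), (2, 1), (2, -1), (-2, 1), (-2, -1)]

theorem mem_moveList {c : ℤ × ℤ} (h : (|c.1| = 1 ∧ |c.2| = 2) ∨ (|c.1| = 2 ∧ |c.2| = 1)) :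
    c ∈ moveList := by
  obtain ⟨a, b⟩ := c
  simp only [abs_eq (zero_le_one' ℤ), abs_eq (zero_le_two (α := ℤ))] at h
  rcases h with ⟨rfl | rfl, rfl | rfl⟩ | ⟨rfl | rfl, rfl | rfl⟩ <;> simp [moveList]

theorem liftMove_mem_moveList (n : ℕ) (p : ℤ × ℤ) (c : Move) :
    liftMove n p c.1 ∈ moveList := by
  refine mem_moveList ?_
  unfold liftMove
  have h := c.2
  split_ifs
  · exact h
  · simpa only [abs_neg] using h

namespace Walk

variable {m n : ℕ} [NeZero m] [NeZero n]

/-- Each displacement has odd coordinate sum, whatever sign the twist puts on it; `w.starts.length`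
counts the moves. -/
theorem liftEnd_parity {u v : Vertex m n} (w : Walk m n u v) : ∀ p : ℤ × ℤ,
    ((w.liftEnd p).1 + (w.liftEnd p).2 - p.1 - p.2 - w.starts.length) % 2 = 0 := by
  induction w with
  | nil v => intro p; simp only [liftEnd, starts, List.length_nil]; omega
  | cons u c w ih =>
    intro p
    have h := ih (p + liftMove n p c.1)
    have hc := liftMove_mem_moveList n p c
    have hd : ∀ d ∈ moveList, (d.1 + d.2 - 1) % 2 = 0 := by decide
    have hd' := hd _ hc
    simp only [liftEnd, starts, List.length_cons, Prod.fst_add, Prod.snd_add] at h ⊢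
    push_cast
    omega

theorem IsTour.length_starts {v : Vertex m n} {w : Walk m n v v} (h : w.IsTour) (h1 : 1 < m * n) :
    w.starts.length = m * n := by
  have hv : ∀ u, u ∈ w.starts := by
    have hne : w.starts ≠ [] := by
      intro h0
      have : Fintype.card (Vertex m n) ≤ 1 :=
        Fintype.card_le_one_iff.mpr fun a b => by
          have ha := h.visits a
          have hb := h.visits b
          simp only [h0, List.not_mem_nil, or_false] at ha hb
          rw [ha, hb]
      simp at this
      omega
    intro u
    rcases h.visits u with rfl | hu
    · exact w.mem_starts hne
    · exact hu
  have h2 := List.toFinset_card_of_nodup h.starts_nodup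
  have : w.starts.toFinset = Finset.univ := Finset.eq_univ_of_forall fun u => by simpa using hv u
  rw [← h2, this]
  simp

end Walk

section

variable {m n : ℕ} [NeZero m] [NeZero n]

theorem not_hasNullhomotopicTour_of_odd (hm : Odd m) (hn : Odd n) (h1 : 1 < m * n) :
    ¬ HasNullhomotopicTour m n := by
  rintro ⟨w, hw, hnull⟩
  have h := (w.isNullhomotopic_iff_liftEnd (0, 0) (proj_zero m n)).mp hnull
  have hp := w.liftEnd_parity (0, 0)
  rw [h, hw.length_starts h1] at hp
  have := hm.mul hn
  rw [Nat.odd_iff] at this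
  omega

theorem toPlane_add_deckZ (v : Vertex m n) (c : Move) : ∃ i : ℤ,
    v.toPlane + c.1 = deckZ m n i ((v.toPlane + c.1).2 / n) (target v c).toPlane :=
  exists_deckZ m n (v.toPlane + c.1)

theorem proj_toPlane (v : Vertex m n) : proj m n v.toPlane = v := by
  obtain ⟨⟨a, ha⟩, ⟨b, hb⟩⟩ := v
  have h1 : ((b : ℤ) / (n : ℤ)) = 0 := Int.ediv_eq_zero_of_lt (by omega) (by omega)
  have h2 : ((a : ℤ) % (m : ℤ)) = a := Int.emod_eq_of_lt (by omega) (by omega)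
  have h3 : ((b : ℤ) % (n : ℤ)) = b := Int.emod_eq_of_lt (by omega) (by omega)
  refine Prod.ext (Fin.ext ?_) (Fin.ext ?_) <;> simp [proj, modZ, Vertex.toPlane, h1, h2, h3]

/-- A move and the move that undoes it are the same edge. -/
theorem edge_back (v : Vertex m n) (c : Move) : edge (target v c) (back v c) = edge v c := by
  have hn : (n : ℤ) ≠ 0 := Int.natCast_ne_zero.mpr (NeZero.ne n)
  obtain ⟨i, hi⟩ := toPlane_add_deckZ v c
  generalize hj : (v.toPlane + c.1).2 / (n : ℤ) = j at hi
  -- The inverse of the deck transformation with indices `i`, `j` has second index `-j` and first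
  -- index `-i` or `i`, according as `j` is even or odd (a glide reflection).
  obtain ⟨k, hk⟩ : ∃ k : ℤ, (target v c).toPlane + (back v c).1 = deckZ m n k (-j) v.toPlane := by
    have h1 := congrArg Prod.fst hi
    have h2 := congrArg Prod.snd hi
    simp only [deckZ, Prod.fst_add, Prod.snd_add] at h1 h2
    by_cases h : Even j
    · refine ⟨-i, Prod.ext ?_ ?_⟩
      · simp only [deckZ, back, hj, h, even_neg, if_true, Prod.fst_add] at h1 ⊢; linarith
      · simp only [deckZ, back, Prod.snd_add]; linarith
    · refine ⟨i, Prod.ext ?_ ?_⟩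
      · simp only [deckZ, back, hj, h, even_neg, if_false, Prod.fst_add] at h1 ⊢; linarith
      · simp only [deckZ, back, Prod.snd_add]; linarith
  have ht : target (target v c) (back v c) = v := by
    rw [target, hk, proj_deckZ, proj_toPlane]
  have hb : back (target v c) (back v c) = c := by
    have e : ((target v c).toPlane + (back v c).1).2 / (n : ℤ) = -j := by
      rw [hk]
      have h0 : v.toPlane.2 / (n : ℤ) = 0 := by
        have := v.2.2
        exact Int.ediv_eq_zero_of_lt (by simp [Vertex.toPlane]) (by simp [Vertex.toPlane])
      simp only [deckZ]
      rw [Int.add_mul_ediv_left _ _ hn, h0, zero_add]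
    refine Subtype.ext (Prod.ext ?_ ?_)
    · rw [back]
      simp only [e, even_neg]
      simp only [back, hj]
      split_ifs <;> ring
    · simp [back]
  rw [edge, ht, hb, edge, Sym2.eq_swap]

/-- A tour would have two moves. As its lift is closed, the second move undoes the first and so
repeats its edge. -/
theorem not_hasNullhomotopicTour_of_two (h2 : m * n = 2) : ¬ HasNullhomotopicTour m n := by
  rintro ⟨w, hw, hnull⟩
  have h := (w.isNullhomotopic_iff_liftEnd (0, 0) (proj_zero m n)).mp hnull
  have hl := hw.length_starts (by omega)
  have he := hw.edges_nodup
  clear hw hnull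
  generalize hb : base m n = b at *
  revert h hl he
  -- Case analysis on a walk needs a free end vertex; closedness is retained through the lift.
  suffices ∀ v (w : Walk m n (base m n) v), w.liftEnd (0, 0) = (0, 0) → w.starts.length = m * n →
      ¬ w.edges.Nodup from by
    subst hb; exact this _ w
  clear w hb b
  intro v w h hl he
  cases w with
  | nil => simp [Walk.starts, h2] at hl
  | cons _ c w =>
  cases w with
  | nil => simp [Walk.starts] at hl; omega
  | cons _ c' w =>
  cases w with
  | cons _ c'' w => simp [Walk.starts] at hl; omega
  | nil =>
    have hc : c' = back (base m n) c := by
      have e0 : (base m n).toPlane = (0, 0) := by simp [base, Vertex.toPlane]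
      have h1 := congrArg Prod.fst h
      have h2 := congrArg Prod.snd h
      simp only [Walk.liftEnd, liftMove, Int.zero_ediv, Even.zero, if_true, Prod.mk_zero_zero,
        Prod.fst_add, Prod.snd_add, zero_add] at h1 h2
      refine Subtype.ext (Prod.ext ?_ ?_)
      · simp only [back, e0, Prod.mk_zero_zero, zero_add]
        split_ifs at h1 ⊢ <;> linarith
      · simp only [back]; linarith
    subst hc
    simp [Walk.edges, edge_back] at he

/-- The four lifted displacements have sum zero, so three of them determine the fourth and there are
`8 ^ 3` cases, each of which repeats a vertex. -/
theorem not_hasNullhomotopicTour_two_two : ¬ HasNullhomotopicTour 2 2 := by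
  rintro ⟨w, hw, hnull⟩
  have h := (w.isNullhomotopic_iff_liftEnd (0, 0) (proj_zero 2 2)).mp hnull
  have hl := hw.length_starts (by omega)
  have hs := hw.starts_nodup
  clear hw hnull
  have key : ∀ a ∈ moveList, ∀ b ∈ moveList, ∀ c ∈ moveList, -(a + b + c) ∈ moveList →
      ¬ [proj 2 2 (0, 0), proj 2 2 a, proj 2 2 (a + b), proj 2 2 (a + b + c)].Nodup := by
    decide +kernel
  suffices ∀ v (w : Walk 2 2 (proj 2 2 (0, 0)) v), w.liftEnd (0, 0) = (0, 0) →
      w.starts.length = 2 * 2 → ¬ w.starts.Nodup from by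
    exact this _ w h hl hs
  clear w h hl hs
  intro v w h hl hs
  cases w with
  | nil => simp [Walk.starts] at hl
  | cons _ a w =>
  cases w with
  | nil => simp [Walk.starts] at hl
  | cons _ b w =>
  cases w with
  | nil => simp [Walk.starts] at hl
  | cons _ c w =>
  cases w with
  | nil => simp [Walk.starts] at hl
  | cons _ d w =>
  cases w with
  | cons _ e w => simp [Walk.starts] at hl
  | nil =>
    simp only [Walk.liftEnd] at h
    simp only [Walk.starts, ← proj_add_liftMove] at hs
    have e0 : ((0 : ℤ), (0 : ℤ)) = 0 := rfl
    have ha := liftMove_mem_moveList 2 (0, 0) a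
    generalize liftMove 2 (0, 0) a.1 = a' at *
    have hb := liftMove_mem_moveList 2 ((0, 0) + a') b
    generalize liftMove 2 ((0, 0) + a') b.1 = b' at *
    have hc := liftMove_mem_moveList 2 ((0, 0) + a' + b') c
    generalize liftMove 2 ((0, 0) + a' + b') c.1 = c' at *
    have hd := liftMove_mem_moveList 2 ((0, 0) + a' + b' + c') d
    generalize liftMove 2 ((0, 0) + a' + b' + c') d.1 = d' at *
    refine key a' ha b' hb c' hc ?_ ?_
    · rw [e0, zero_add] at h
      rwa [neg_eq_of_add_eq_zero_right h]
    · simpa only [e0, zero_add] using hs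

end

/-! ### Nested insertions into a path -/

/-- The path from `a` to `b` that arises from the path `[a, b]` by `K` nested insertions, each of them
moved by `(g, 0)` against the previous one. -/
def nest (a b : ℤ × ℤ) (g : ℤ) (A B : List (ℤ × ℤ)) : ℕ → List (ℤ × ℤ)
  | 0 => [a, b]
  | K + 1 => A ++ (nest a b g A B K).map (· + (g, 0)) ++ B

/-- The conditions under which all the lists `nest a b g A B K` are paths. -/
structure IsNest (a b : ℤ × ℤ) (g : ℤ) (A B : List (ℤ × ℤ)) : Prop where
  adj : Adj a b
  chain_left : List.IsChain Adj (A ++ [a + (g, 0)])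
  chain_right : List.IsChain Adj ((b + (g, 0)) :: B)
  head : A.head? = some a
  last : B.getLast? = some b

variable {a b : ℤ × ℤ} {g : ℤ} {A B : List (ℤ × ℤ)}

theorem isChain_map_add {l : List (ℤ × ℤ)} (h : List.IsChain Adj l) (t : ℤ × ℤ) :
    List.IsChain Adj (l.map (· + t)) :=
  (List.isChain_map _).mpr (h.imp fun _ _ h => h.add t)

/-- The surroundings `Z₁`, `Z₂` see only the ends of `l`, so inside a tour `[a, b]` may be exchanged
for any path from `a` to `b`. -/
theorem isChain_insert {l Z₁ Z₂ : List (ℤ × ℤ)} (h : List.IsChain Adj l) (ha : l.head? = some a)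
    (hb : l.getLast? = some b) (h₁ : List.IsChain Adj (Z₁ ++ [a]))
    (h₂ : List.IsChain Adj (b :: Z₂)) : List.IsChain Adj (Z₁ ++ l ++ Z₂) := by
  rw [List.isChain_append] at h₁
  have h₂' : List.IsChain Adj ([b] ++ Z₂) := h₂
  rw [List.isChain_append] at h₂'
  refine List.isChain_append.mpr ⟨List.isChain_append.mpr ⟨h₁.1, h, ?_⟩, h₂'.2.1, ?_⟩
  · rw [ha]; exact h₁.2.2
  · rw [List.getLast?_append, hb]; exact h₂'.2.2

theorem head?_insert {l Z₁ Z₂ : List (ℤ × ℤ)} (ha : l.head? = some a) :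
    (Z₁ ++ l ++ Z₂).head? = (Z₁ ++ [a]).head? := by
  simp [List.head?_append, ha]

theorem getLast?_insert {l Z₁ Z₂ : List (ℤ × ℤ)} (hb : l.getLast? = some b) :
    (Z₁ ++ l ++ Z₂).getLast? = (b :: Z₂).getLast? := by
  have : b :: Z₂ = [b] ++ Z₂ := rfl
  rw [this, List.getLast?_append, List.getLast?_append, List.getLast?_append, hb]
  simp

/-- `A` begins at `a` and `B` ends at `b`, so the ends do not depend on `K` and the translated path
always fits between `A` and `B`. -/
theorem IsNest.spec (h : IsNest a b g A B) (K : ℕ) : List.IsChain Adj (nest a b g A B K) ∧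
    (nest a b g A B K).head? = some a ∧ (nest a b g A B K).getLast? = some b := by
  induction K with
  | zero => simp [nest, h.adj]
  | succ K ih =>
    have hh : ((nest a b g A B K).map (· + (g, 0))).head? = some (a + (g, 0)) := by
      simp [ih.2.1]
    have hl : ((nest a b g A B K).map (· + (g, 0))).getLast? = some (b + (g, 0)) := by
      simp [ih.2.2]
    refine ⟨isChain_insert (isChain_map_add ih.1 _) hh hl h.chain_left h.chain_right, ?_, ?_⟩
    · rw [nest, head?_insert hh, List.head?_append, h.head]; rfl
    · rw [nest, getLast?_insert hl]
      have : (b + (g, 0)) :: B = [b + (g, 0)] ++ B := rfl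
      rw [this, List.getLast?_append, h.last]; rfl

theorem length_nest (K : ℕ) :
    (nest a b g A B K).length = 2 + (A.length + B.length) * K := by
  induction K with
  | zero => simp [nest]
  | succ K ih => simp only [nest, List.length_append, List.length_map, ih]; ring

theorem IsNest.mem_nest_zero (h : IsNest a b g A B) (K : ℕ) {c : ℤ × ℤ} (hc : c ∈ [a, b]) :
    c ∈ nest a b g A B K := by
  simp only [List.mem_cons, List.not_mem_nil, or_false] at hc
  rcases hc with rfl | rfl
  · exact List.mem_of_mem_head? (h.spec K).2.1
  · exact List.mem_of_mem_getLast? (h.spec K).2.2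

/-- The squares that one insertion adds to `[a, b]` are those of `A` and `B` other than `a`, `b`,
together with the translates of `a` and `b`. Layer `i` adds the same set moved by `g * i`. -/
theorem IsNest.mem_nest (h : IsNest a b g A B) {c : ℤ × ℤ}
    (hc : c ∈ A ++ B ++ [a + (g, 0), b + (g, 0)]) :
    ∀ K i : ℕ, i < K → c + (g * i, 0) ∈ nest a b g A B K := by
  intro K
  induction K with
  | zero => intro i hi; omega
  | succ K ih =>
    intro i hi
    simp only [nest, List.mem_append, List.mem_map]
    cases i with
    | zero =>
      have e : c + (g * ((0 : ℕ) : ℤ), 0) = c := by simp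
      rw [e]
      simp only [List.mem_append, List.mem_cons, List.not_mem_nil, or_false] at hc
      rcases hc with (hc | hc) | rfl | rfl
      · exact Or.inl (Or.inl hc)
      · exact Or.inr hc
      · exact Or.inl (Or.inr ⟨a, h.mem_nest_zero K (by simp), rfl⟩)
      · exact Or.inl (Or.inr ⟨b, h.mem_nest_zero K (by simp), rfl⟩)
    | succ i =>
      refine Or.inl (Or.inr ⟨_, ih i (by omega), ?_⟩)
      exact Prod.ext (by simp; ring) (by simp)

/-! ### Bands: tours of horizontal strips that can be joined -/

/-- Rows of squares: in each of the rows `0, …, k - 1` there are `w` squares of the list, at distance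
`d` from each other, and there are no further squares. -/
def HasRows (d : ℤ) (k : ℕ) (s : ℕ → ℤ) (w : ℕ) (l : List (ℤ × ℤ)) : Prop :=
  l.length = k * w ∧ ∀ r < k, ∀ j < w, (s r + d * j, (r : ℤ)) ∈ l

/-- The ends of two paths that arise from a closed tour of the rows `0, …, k - 1` if a move between
the top two rows and a move between the bottom two rows are removed. -/
def BandEnds (k x y : ℤ) (P Q : List (ℤ × ℤ)) : Prop :=
  P.head? = some (x - 2, k - 1) ∧ Q.head? = some (x, k - 2) ∧
    ((P.getLast? = some (y - 2, 1) ∧ Q.getLast? = some (y, 0)) ∨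
      (P.getLast? = some (y, 0) ∧ Q.getLast? = some (y - 2, 1)))

instance (k x y : ℤ) (P Q : List (ℤ × ℤ)) : Decidable (BandEnds k x y P Q) :=
  inferInstanceAs (Decidable (_ ∧ _ ∧ _))

/-- The squares of the list form a closed tour of `k` rows that contains the moves from `(x, k - 2)`
to `(x - 2, k - 1)` and from `(y, 0)` to `(y - 2, 1)`. -/
def Band (k x y : ℤ) (l : List (ℤ × ℤ)) : Prop :=
  ∃ P Q, l.Perm (P ++ Q) ∧ List.IsChain Adj P ∧ List.IsChain Adj Q ∧ BandEnds k x y P Q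

/-- `O` and `Z₁ ++ [a, b] ++ Z₂` are the two paths of the band of width `m₀`. Exchanging `[a, b]`
for a nest preserves their ends, and each layer prolongs every row by `p` squares at spacing `d`,
because `g = d * p`. All hypotheses are finite checks, independent of `K`. -/
theorem IsNest.exists_band (h : IsNest a b g A B) {d k x y : ℤ} {k' m₀ p : ℕ} {s : ℕ → ℤ}
    {O Z₁ Z₂ : List (ℤ × ℤ)} (hg : g = d * p) (hp : 0 < p) (hO : List.IsChain Adj O)
    (h₁ : List.IsChain Adj (Z₁ ++ [a])) (h₂ : List.IsChain Adj (b :: Z₂))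
    (hends : BandEnds k x y O (Z₁ ++ [a, b] ++ Z₂) ∨ BandEnds k x y (Z₁ ++ [a, b] ++ Z₂) O)
    (hlen₀ : O.length + (Z₁.length + 2 + Z₂.length) = k' * m₀)
    (hlen₁ : A.length + B.length = k' * p)
    (hrow₀ : ∀ r < k', ∀ j < m₀, (s r + d * j, (r : ℤ)) ∈ O ++ (Z₁ ++ [a, b] ++ Z₂))
    (hrow₁ : ∀ r < k', ∀ j < p, (s r + d * (m₀ + j : ℕ), (r : ℤ)) ∈
      A ++ B ++ [a + (g, 0), b + (g, 0)]) (K : ℕ) :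
    ∃ l, Band k x y l ∧ HasRows d k' s (m₀ + p * K) l := by
  obtain ⟨hc, hh, hl⟩ := h.spec K
  have hZ := isChain_insert hc hh hl h₁ h₂
  have e1 : (Z₁ ++ nest a b g A B K ++ Z₂).head? = (Z₁ ++ [a, b] ++ Z₂).head? := by
    rw [head?_insert hh, head?_insert (a := a) rfl]
  have e2 : (Z₁ ++ nest a b g A B K ++ Z₂).getLast? = (Z₁ ++ [a, b] ++ Z₂).getLast? := by
    rw [getLast?_insert hl, getLast?_insert (b := b) rfl]
  refine ⟨O ++ (Z₁ ++ nest a b g A B K ++ Z₂), ?_, ?_, ?_⟩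
  · rcases hends with hends | hends
    · refine ⟨O, _, List.Perm.refl _, hO, hZ, ?_⟩
      unfold BandEnds at *
      rwa [e1, e2]
    · refine ⟨_, O, List.perm_append_comm, hZ, hO, ?_⟩
      unfold BandEnds at *
      rwa [e1, e2]
  · have := length_nest (a := a) (b := b) (g := g) (A := A) (B := B) K
    simp only [List.length_append, this, hlen₁]
    have e : k' * (m₀ + p * K) = k' * m₀ + k' * p * K := by ring
    rw [e, ← hlen₀]; ring
  · intro r hr j hj
    by_cases hjm : j < m₀
    · have := hrow₀ r hr j hjm
      simp only [List.mem_append] at this ⊢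
      rcases this with h' | (h' | h') | h'
      · exact Or.inl h'
      · exact Or.inr (Or.inl (Or.inl h'))
      · exact Or.inr (Or.inl (Or.inr (h.mem_nest_zero K h')))
      · exact Or.inr (Or.inr h')
    -- Position `j` beyond the first `m₀` lies in layer `(j - m₀) / p`, at place `(j - m₀) % p`.
    · have hq : (j - m₀) / p < K := by
        rw [Nat.div_lt_iff_lt_mul hp]; rw [mul_comm]; omega
      have := h.mem_nest (hrow₁ r hr ((j - m₀) % p) (Nat.mod_lt _ hp)) K ((j - m₀) / p) hq
      have e : (s r + d * ((m₀ + (j - m₀) % p : ℕ) : ℤ), (r : ℤ)) + (g * ((j - m₀) / p : ℕ), 0) =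
          (s r + d * j, (r : ℤ)) := by
        have hj' : (j : ℤ) = m₀ + (((j - m₀) % p : ℕ) : ℤ) + p * (((j - m₀) / p : ℕ) : ℤ) := by
          have := Nat.mod_add_div (j - m₀) p
          have h2 : j = m₀ + (j - m₀) % p + p * ((j - m₀) / p) := by omega
          exact_mod_cast h2
        refine Prod.ext ?_ (by simp)
        rw [hg]
        conv_rhs => rw [hj']
        push_cast
        simp only [Prod.fst_add]
        ring
      rw [e] at this
      simp only [List.mem_append]
      exact Or.inr (Or.inl (Or.inr this))

theorem Band.adj_top (k x : ℤ) : Adj (x - 2, k - 1) (x, k - 2) := by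
  refine Or.inr ⟨?_, ?_⟩
  · simp
  · have : k - 2 - (k - 1) = -1 := by ring
    simp [this]

/-- Restoring the two removed moves closes the reversed first path followed by the second. -/
theorem Band.exists_isLoop {k x y : ℤ} {l : List (ℤ × ℤ)} (h : Band k x y l) :
    ∃ l', l.Perm l' ∧ IsLoop l' := by
  obtain ⟨P, Q, hl, hP, hQ, hp, hq, he⟩ := h
  refine ⟨P.reverse ++ Q, hl.trans ((List.reverse_perm P).symm.append_right Q),
    List.isChain_append.mpr ⟨?_, hQ, ?_⟩, ?_⟩
  · rw [List.isChain_reverse]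
    exact hP.imp fun _ _ h => h.symm
  · rw [List.getLast?_reverse, hp, hq]
    rintro _ ⟨⟩ _ ⟨⟩
    exact Band.adj_top k x
  -- The bottom move has the form of the top move of a band of two rows.
  · have hb : Adj (y - 2, 1) (y, 0) := Band.adj_top 2 y
    rw [List.getLast?_append, List.head?_append, List.head?_reverse]
    rcases he with ⟨h1, h2⟩ | ⟨h1, h2⟩
    · rw [h1, h2]
      rintro _ ⟨⟩ _ ⟨⟩
      exact hb.symm
    · rw [h1, h2]
      rintro _ ⟨⟩ _ ⟨⟩
      exact hb

/-- Two bands, one above the other, can be joined. -/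
theorem Band.append {k x y k' x' y' : ℤ} {l l' : List (ℤ × ℤ)} (h : Band k x y l)
    (h' : Band k' x' y' l') : Band (k + k') (x' + (x + 1 - y')) y
      (l ++ l'.map (· + (x + 1 - y', k))) := by
  obtain ⟨P, Q, hl, hP, hQ, hp, hq, he⟩ := h
  obtain ⟨P', Q', hl', hP', hQ', hp', hq', he'⟩ := h'
  -- This shift makes the bottom move of the upper band the translate by `(1, 2)` of the top move of
  -- the lower one, so corresponding ends are a knight's move apart.
  set t : ℤ × ℤ := (x + 1 - y', k) with ht
  have a1 : Adj ((y' - 2, 1) + t) (x - 2, k - 1) := by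
    refine Or.inl ⟨?_, ?_⟩
    · simp [ht]
    · have : k - 1 - (1 + k) = -2 := by ring
      simp [ht, this]
  have a2 : Adj ((y', 0) + t) (x, k - 2) := by
    refine Or.inl ⟨?_, ?_⟩
    · simp [ht]
    · simp [ht]
  have key : ∀ {U V : List (ℤ × ℤ)} {u v : ℤ × ℤ}, List.IsChain Adj U → List.IsChain Adj V →
      U.getLast? = some u → V.head? = some v → Adj (u + t) v →
      List.IsChain Adj (U.map (· + t) ++ V) := by
    intro U V u v hU hV hu hv huv
    refine List.isChain_append.mpr ⟨isChain_map_add hU t, hV, ?_⟩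
    rw [List.getLast?_map, hu, hv]
    rintro _ ⟨⟩ _ ⟨⟩
    exact huv
  have hhead : ∀ {U V : List (ℤ × ℤ)} {u : ℤ × ℤ}, U.head? = some u →
      (U.map (· + t) ++ V).head? = some (u + t) := by
    intro U V u hu
    simp [List.head?_append, hu]
  have hlast : ∀ {U V : List (ℤ × ℤ)} {v : ℤ × ℤ}, V.getLast? = some v →
      (U.map (· + t) ++ V).getLast? = some v := by
    intro U V v hv
    simp [List.getLast?_append, hv]
  have e1 : ((x' - 2, k' - 1) : ℤ × ℤ) + t = (x' + (x + 1 - y') - 2, k + k' - 1) :=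
    Prod.ext (by simp [ht]; ring) (by simp [ht]; ring)
  have e2 : ((x', k' - 2) : ℤ × ℤ) + t = (x' + (x + 1 - y'), k + k' - 2) :=
    Prod.ext (by simp [ht]) (by simp [ht]; ring)
  have hperm : (l ++ l'.map (· + t)).Perm ((P ++ Q) ++ (P'.map (· + t) ++ Q'.map (· + t))) := by
    rw [← List.map_append]
    exact hl.append (hl'.map _)
  -- The bottom ends of `P'` and `Q'` decide whether `P'` continues along `P` or along `Q`; either
  -- way two paths remain.
  rcases he' with ⟨h1, h2⟩ | ⟨h1, h2⟩
  · refine ⟨P'.map (· + t) ++ P, Q'.map (· + t) ++ Q, hperm.trans ?_, key hP' hP h1 hp a1,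
      key hQ' hQ h2 hq a2, ?_, ?_, ?_⟩
    · rw [← Multiset.coe_eq_coe]
      simp only [← Multiset.coe_add]
      abel
    · rw [hhead hp', e1]
    · rw [hhead hq', e2]
    · rcases he with ⟨h3, h4⟩ | ⟨h3, h4⟩
      · exact Or.inl ⟨hlast h3, hlast h4⟩
      · exact Or.inr ⟨hlast h3, hlast h4⟩
  · refine ⟨P'.map (· + t) ++ Q, Q'.map (· + t) ++ P, hperm.trans ?_, key hP' hQ h1 hq a2,
      key hQ' hP h2 hp a1, ?_, ?_, ?_⟩
    · rw [← Multiset.coe_eq_coe]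
      simp only [← Multiset.coe_add]
      abel
    · rw [hhead hp', e1]
    · rw [hhead hq', e2]
    · rcases he with ⟨h3, h4⟩ | ⟨h3, h4⟩
      · exact Or.inr ⟨hlast h4, hlast h3⟩
      · exact Or.inl ⟨hlast h4, hlast h3⟩

/-- There is a closed tour of `k` rows, each of width `m`, that can be joined to others. Its rows are
complete systems of residues modulo `m`. -/
def HasStrip (k m : ℕ) : Prop :=
  ∃ x y l, Band k x y l ∧ l.length = k * m ∧ ∀ r < k, ∀ a : ℤ, ∃ i : ℤ, (a + m * i, (r : ℤ)) ∈ l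

theorem HasStrip.add {k k' m : ℕ} (h : HasStrip k m) (h' : HasStrip k' m) :
    HasStrip (k + k') m := by
  obtain ⟨x, y, l, hb, hl, hr⟩ := h
  obtain ⟨x', y', l', hb', hl', hr'⟩ := h'
  refine ⟨_, _, _, by simpa using hb.append hb', by simp [hl, hl', add_mul], fun r hrk a => ?_⟩
  simp only [List.mem_append, List.mem_map]
  by_cases hk : r < k
  · obtain ⟨i, hi⟩ := hr r hk a
    exact ⟨i, Or.inl hi⟩
  · obtain ⟨i, hi⟩ := hr' (r - k) (by omega) (a - (x + 1 - y'))
    refine ⟨i, Or.inr ⟨_, hi, Prod.ext ?_ ?_⟩⟩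
    · simp only [Prod.fst_add]; ring
    · simp only [Prod.snd_add]; omega

/-- A strip of full height represents every vertex by horizontal translation alone; the twist plays
no part. -/
theorem HasStrip.hasNullhomotopicTour {m n : ℕ} [NeZero m] [NeZero n] (h : HasStrip n m)
    (h3 : 3 ≤ m * n) : HasNullhomotopicTour m n := by
  obtain ⟨x, y, l, hb, hl, hr⟩ := h
  obtain ⟨l', hp, hloop⟩ := hb.exists_isLoop
  refine hasNullhomotopicTour_of_isLoop m n l' hloop (by rw [← hp.length_eq, hl, mul_comm]) h3 ?_
  intro v
  obtain ⟨i, hi⟩ := hr v.2 v.2.2 v.1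
  refine ⟨_, hp.mem_iff.mp hi, ?_⟩
  have := proj_deckZ m n i 0 v.toPlane
  simpa [deckZ, Vertex.toPlane, proj_toPlane] using this.trans (proj_toPlane v)

theorem HasStrip.of_forall_emod {k m : ℕ} {x y : ℤ} {l : List (ℤ × ℤ)} (hm : 0 < m)
    (h : Band k x y l) (hl : l.length = k * m)
    (hr : ∀ r < k, ∀ j < m, ∃ c ∈ l, c.2 = (r : ℤ) ∧ c.1 % m = (j : ℕ)) : HasStrip k m := by
  refine ⟨x, y, l, h, hl, fun r hrk a => ?_⟩
  have hm' : (0 : ℤ) < m := by exact_mod_cast hm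
  have h1 := Int.emod_nonneg a hm'.ne'
  have h2 := Int.emod_lt_of_pos a hm'
  obtain ⟨c, hc, hc2, hc1⟩ := hr r hrk (a % m).toNat (by omega)
  rw [Int.toNat_of_nonneg h1] at hc1
  refine ⟨c.1 / m - a / m, ?_⟩
  convert! hc using 1
  refine Prod.ext ?_ hc2.symm
  linear_combination Int.emod_add_mul_ediv c.1 m - Int.emod_add_mul_ediv a m - hc1

theorem HasStrip.of_hasRows_one {k m : ℕ} {x y : ℤ} {s : ℕ → ℤ} {l : List (ℤ × ℤ)} (hm : 0 < m)
    (h : Band k x y l) (hr : HasRows 1 k s m l) : HasStrip k m := by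
  refine ⟨x, y, l, h, hr.1, fun r hrk a => ?_⟩
  have hm' : (0 : ℤ) < m := by exact_mod_cast hm
  have h1 := Int.emod_nonneg (a - s r) hm'.ne'
  have h2 := Int.emod_lt_of_pos (a - s r) hm'
  have h3 := Int.emod_def (a - s r) m
  have := hr.2 r hrk ((a - s r) % m).toNat (by omega)
  refine ⟨-((a - s r) / m), ?_⟩
  convert! this using 2
  rw [Int.toNat_of_nonneg h1, h3]
  ring

theorem HasStrip.of_hasRows_two {k m : ℕ} {x y : ℤ} {s : ℕ → ℤ} {l : List (ℤ × ℤ)} (hm : Odd m)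
    (h : Band k x y l) (hr : HasRows 2 k s m l) : HasStrip k m := by
  refine ⟨x, y, l, h, hr.1, fun r hrk a => ?_⟩
  have hm' : (0 : ℤ) < m := by exact_mod_cast hm.pos
  obtain ⟨u, hu⟩ := hm
  -- For `m = 2 * u + 1`, the inverse of 2 modulo `m` is `u + 1`.
  set z := (a - s r) * (u + 1) with hz
  have h1 := Int.emod_nonneg z hm'.ne'
  have h2 := Int.emod_lt_of_pos z hm'
  have h3 := Int.emod_def z m
  have := hr.2 r hrk (z % m).toNat (by omega)
  refine ⟨(a - s r) - 2 * (z / m), ?_⟩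
  convert! this using 2
  rw [Int.toNat_of_nonneg h1, h3]
  have hu' : (m : ℤ) = 2 * u + 1 := by exact_mod_cast hu
  have e : 2 * z = (a - s r) * (m + 1) := by rw [hz, hu']; ring
  linear_combination -e

/-! ### Bands of three to seven rows -/

theorem hasStrip_three_two : HasStrip 3 2 :=
  HasStrip.of_forall_emod (x := 3) (y := 5) (by decide)
    ⟨[(1, 2), (0, 0), (2, 1), (4, 2), (5, 0)],
      [(3, 1)],
      List.Perm.refl _, by decide, by decide, by decide⟩ (by decide) (by decide)

theorem hasStrip_five_two : HasStrip 5 2 :=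
  HasStrip.of_forall_emod (x := 4) (y := 0) (by decide)
    ⟨[(2, 4), (1, 2), (0, 0)],
      [(4, 3), (5, 1), (3, 0), (2, 2), (1, 4), (-1, 3), (-2, 1)],
      List.Perm.refl _, by decide, by decide, by decide⟩ (by decide) (by decide)

theorem hasStrip_seven_two : HasStrip 7 2 :=
  HasStrip.of_forall_emod (x := 5) (y := 0) (by decide)
    ⟨[(3, 6), (2, 4), (1, 2), (0, 0)],
      [(5, 5), (4, 3), (5, 1), (3, 0), (4, 2), (3, 4), (2, 6), (0, 5), (-1, 3), (-2, 1)],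
      List.Perm.refl _, by decide, by decide, by decide⟩ (by decide) (by decide)

/-- The rows may start at different columns, since only residues modulo the width matter. The
default of `getD` is never reached. The same holds for the families that follow. -/
theorem exists_band_three_four (K : ℕ) : ∃ l, Band 3 (-1) (-2) l ∧
    HasRows 1 3 (fun r => [-4, -4, -3].getD r 0) (4 + 4 * K) l :=
  IsNest.exists_band (a := (-1, 2)) (b := (-2, 0)) (g := 4)
    (A := [(-1, 2), (0, 0), (2, 1), (4, 2), (3, 0), (1, 1)])
    (B := [(1, 2), (3, 1), (1, 0), (2, 2), (0, 1), (-2, 0)])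
    (O := [(-1, 1), (-3, 0), (-2, 2), (-4, 1)])
    (Z₁ := [(-3, 2), (-4, 0), (-2, 1), (0, 2), (-1, 0), (-3, 1)])
    (Z₂ := [])
    ⟨by decide, by decide, by decide, by decide, by decide⟩ (by decide) (by decide) (by decide)
    (by decide) (by decide) (by decide) (by decide) (by decide) (by decide) (by decide) K

theorem exists_band_three_six (K : ℕ) : ∃ l, Band 3 (-4) (-3) l ∧
    HasRows 1 3 (fun r => [-6, -8, -6].getD r 0) (6 + 4 * K) l :=
  IsNest.exists_band (a := (-2, 2)) (b := (-3, 0)) (g := 4)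
    (A := [(-2, 2), (0, 1), (2, 0), (3, 2), (1, 1), (3, 0)])
    (B := [(0, 2), (-2, 1), (0, 0), (1, 2), (-1, 1), (-3, 0)])
    (O := [(-6, 2), (-8, 1), (-6, 0), (-5, 2), (-7, 1), (-5, 0), (-4, 2), (-6, 1), (-4, 0), (-3, 2),
      (-5, 1)])
    (Z₁ := [(-4, 1), (-2, 0), (-1, 2), (-3, 1), (-1, 0)])
    (Z₂ := [])
    ⟨by decide, by decide, by decide, by decide, by decide⟩ (by decide) (by decide) (by decide)
    (by decide) (by decide) (by decide) (by decide) (by decide) (by decide) (by decide) K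

theorem exists_band_five_four (K : ℕ) : ∃ l, Band 5 (-2) (-2) l ∧
    HasRows 1 5 (fun r => [-4, -4, -4, -3, -4].getD r 0) (4 + 4 * K) l :=
  IsNest.exists_band (a := (-1, 2)) (b := (-2, 0)) (g := 4)
    (A := [(-1, 2), (0, 0), (2, 1), (1, 3), (3, 4), (2, 2), (3, 0), (1, 1), (2, 3), (0, 4), (1, 2),
      (3, 3), (1, 4), (0, 2), (1, 0), (3, 1), (4, 3), (2, 4)])
    (B := [(0, 1), (-2, 0)])
    (O := [(-2, 3), (-3, 1), (-1, 0), (-2, 2), (-1, 4), (-3, 3), (-4, 1)])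
    (Z₁ := [(-4, 4), (-3, 2), (-4, 0), (-2, 1), (-1, 3), (-3, 4), (-4, 2), (-3, 0), (-1, 1), (0, 3),
      (-2, 4)])
    (Z₂ := [])
    ⟨by decide, by decide, by decide, by decide, by decide⟩ (by decide) (by decide) (by decide)
    (by decide) (by decide) (by decide) (by decide) (by decide) (by decide) (by decide) K

theorem exists_band_five_six (K : ℕ) : ∃ l, Band 5 (-4) (-2) l ∧
    HasRows 1 5 (fun r => [-6, -6, -6, -6, -6].getD r 0) (6 + 4 * K) l :=
  IsNest.exists_band (a := (-1, 2)) (b := (-2, 0)) (g := 4)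
    (A := [(-1, 2), (0, 4), (2, 3), (3, 1), (1, 0), (0, 2), (1, 4), (3, 3), (1, 2), (0, 0), (2, 1),
      (1, 3), (3, 4), (2, 2), (3, 0), (1, 1), (0, 3), (2, 4)])
    (B := [(0, 1), (-2, 0)])
    (O := [(-6, 4), (-5, 2), (-6, 0), (-4, 1)])
    (Z₁ := [(-4, 3), (-5, 1), (-6, 3), (-4, 4), (-2, 3), (-1, 1), (-3, 0), (-4, 2), (-5, 4), (-6, 2),
      (-5, 0), (-3, 1), (-1, 0), (-2, 2), (-1, 4), (-3, 3), (-2, 1), (-1, 3), (-3, 4), (-5, 3),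
      (-6, 1), (-4, 0), (-3, 2), (-2, 4)])
    (Z₂ := [])
    ⟨by decide, by decide, by decide, by decide, by decide⟩ (by decide) (by decide) (by decide)
    (by decide) (by decide) (by decide) (by decide) (by decide) (by decide) (by decide) K

theorem exists_band_seven_four (K : ℕ) : ∃ l, Band 7 0 (-2) l ∧
    HasRows 1 7 (fun r => [-4, -4, -4, -4, -4, -3, -4].getD r 0) (4 + 4 * K) l :=
  IsNest.exists_band (a := (-1, 2)) (b := (-2, 0)) (g := 4)
    (A := [(-1, 2), (0, 4), (1, 6), (3, 5), (2, 3), (3, 1), (1, 0), (0, 2), (1, 4), (0, 6), (2, 5),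
      (3, 3), (1, 2), (0, 0), (2, 1), (1, 3), (3, 4), (2, 6), (4, 5), (2, 4), (3, 6), (1, 5),
      (0, 3), (2, 2), (3, 0), (1, 1)])
    (B := [(0, 1), (-2, 0)])
    (O := [(-2, 6), (-1, 4), (-3, 3), (-4, 1)])
    (Z₁ := [(0, 5), (-1, 3), (-2, 1), (-4, 0), (-3, 2), (-1, 1), (-3, 0), (-4, 2), (-3, 4), (-4, 6),
      (-2, 5), (-4, 4), (-3, 6), (-1, 5), (-2, 3), (-3, 1), (-1, 0), (-2, 2), (-4, 3), (-3, 5),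
      (-1, 6), (-2, 4)])
    (Z₂ := [])
    ⟨by decide, by decide, by decide, by decide, by decide⟩ (by decide) (by decide) (by decide)
    (by decide) (by decide) (by decide) (by decide) (by decide) (by decide) (by decide) K

theorem exists_band_seven_six (K : ℕ) : ∃ l, Band 7 (-2) (-2) l ∧
    HasRows 1 7 (fun r => [-6, -6, -6, -6, -6, -6, -6].getD r 0) (6 + 4 * K) l :=
  IsNest.exists_band (a := (-1, 2)) (b := (-2, 0)) (g := 4)
    (A := [(-1, 2), (0, 4), (1, 6), (3, 5), (2, 3), (3, 1), (1, 0), (0, 2), (1, 4), (0, 6), (2, 5),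
      (3, 3), (1, 2), (0, 0), (2, 1), (1, 3), (3, 4), (2, 6), (0, 5), (2, 4), (3, 6), (1, 5),
      (0, 3), (2, 2), (3, 0), (1, 1)])
    (B := [(0, 1), (-2, 0)])
    (O := [(-4, 6), (-6, 5), (-5, 3), (-6, 1), (-4, 0), (-5, 2), (-6, 0), (-4, 1)])
    (Z₁ := [(-2, 5), (-1, 3), (-2, 1), (-3, 3), (-1, 4), (-2, 6), (-4, 5), (-6, 6), (-5, 4), (-6, 2),
      (-5, 0), (-3, 1), (-1, 0), (-2, 2), (-3, 0), (-1, 1), (-3, 2), (-5, 1), (-6, 3), (-4, 2),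
      (-3, 4), (-5, 5), (-4, 3), (-6, 4), (-5, 6), (-4, 4), (-3, 6), (-1, 5), (-2, 3), (-3, 5),
      (-1, 6), (-2, 4)])
    (Z₂ := [])
    ⟨by decide, by decide, by decide, by decide, by decide⟩ (by decide) (by decide) (by decide)
    (by decide) (by decide) (by decide) (by decide) (by decide) (by decide) (by decide) K

/-- Each row uses columns of one parity. The family serves twice: with odd `m` as the number of
squares per row, and with half the width of a board of height four. -/
theorem exists_band_four_one (K : ℕ) : ∃ l, Band 4 (-1) (-2) l ∧
    HasRows 2 4 (fun r => [-2, -4, -1, -3].getD r 0) (1 + 2 * K) l :=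
  IsNest.exists_band (a := (-1, 2)) (b := (-2, 0)) (g := 4)
    (A := [(-1, 2), (1, 3)])
    (B := [(1, 2), (0, 0), (-2, 1), (-1, 3), (0, 1), (-2, 0)])
    (O := [(-3, 3), (-4, 1)])
    (Z₁ := [])
    (Z₂ := [])
    ⟨by decide, by decide, by decide, by decide, by decide⟩ (by decide) (by decide) (by decide)
    (by decide) (by decide) (by decide) (by decide) (by decide) (by decide) (by decide) K

theorem exists_band_four_two (K : ℕ) : ∃ l, Band 4 (-3) (-2) l ∧
    HasRows 2 4 (fun r => [-4, -4, -3, -5].getD r 0) (2 + 2 * K) l :=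
  IsNest.exists_band (a := (-1, 2)) (b := (-2, 0)) (g := 4)
    (A := [(-1, 2), (0, 0), (2, 1), (1, 3)])
    (B := [(1, 2), (-1, 3), (0, 1), (-2, 0)])
    (O := [(-5, 3), (-4, 1)])
    (Z₁ := [(-3, 2), (-4, 0), (-2, 1), (-3, 3)])
    (Z₂ := [])
    ⟨by decide, by decide, by decide, by decide, by decide⟩ (by decide) (by decide) (by decide)
    (by decide) (by decide) (by decide) (by decide) (by decide) (by decide) (by decide) K

theorem exists_band_six_one (K : ℕ) : ∃ l, Band 6 0 (-2) l ∧
    HasRows 2 6 (fun r => [-2, -4, -1, -3, 0, -2].getD r 0) (1 + 2 * K) l :=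
  IsNest.exists_band (a := (-2, 5)) (b := (-3, 3)) (g := 4)
    (A := [(-2, 5), (-1, 3), (0, 5), (2, 4), (3, 2), (4, 4)])
    (B := [(0, 1), (2, 0), (1, 2), (0, 0), (-2, 1), (-3, 3)])
    (O := [(0, 4), (-1, 2), (-2, 0)])
    (Z₁ := [])
    (Z₂ := [(-4, 1)])
    ⟨by decide, by decide, by decide, by decide, by decide⟩ (by decide) (by decide) (by decide)
    (by decide) (by decide) (by decide) (by decide) (by decide) (by decide) (by decide) K

/-! ### Boards of height one and two -/

/-- Nested insertions into a closed tour of a Klein bottle board give closed tours of larger boards. -/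
theorem IsNest.hasNullhomotopicTour {a b : ℤ × ℤ} {g : ℤ} {A B : List (ℤ × ℤ)}
    (h : IsNest a b g A B) {Z₁ Z₂ : List (ℤ × ℤ)} (h₁ : List.IsChain Adj (Z₁ ++ [a]))
    (h₂ : List.IsChain Adj (b :: Z₂))
    (hclose : ∀ u ∈ (b :: Z₂).getLast?, ∀ v ∈ (Z₁ ++ [a]).head?, Adj u v)
    {m n : ℕ} [NeZero m] [NeZero n] (K : ℕ)
    (hlen : Z₁.length + 2 + Z₂.length + (A.length + B.length) * K = m * n) (h3 : 3 ≤ m * n)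
    (hcov : ∀ r < n, ∀ c < m, ∃ (x y : ℤ) (t : ℕ), ((x, y) ∈ Z₁ ++ [a, b] ++ Z₂ ∧ t = 0 ∨
      (x, y) ∈ A ++ B ++ [a + (g, 0), b + (g, 0)] ∧ t < K) ∧ ∃ i j : ℤ, r + n * j = y ∧
      (Even j ∧ c + m * i = x + g * t ∨ ¬ Even j ∧ -1 - c + m * i = x + g * t)) :
    HasNullhomotopicTour m n := by
  obtain ⟨hc, hh, hl⟩ := h.spec K
  refine hasNullhomotopicTour_of_isLoop m n (Z₁ ++ nest a b g A B K ++ Z₂)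
    ⟨isChain_insert hc hh hl h₁ h₂, ?_⟩ ?_ h3 fun v => ?_
  · rw [getLast?_insert hl, head?_insert hh]
    exact hclose
  · simp only [List.length_append, length_nest]
    rw [← hlen]; ring
  · obtain ⟨x, y, t, hm, i, j, hy, hx⟩ := hcov v.2 v.2.2 v.1 v.1.2
    have e : deckZ m n i j v.toPlane = (x, y) + (g * t, 0) := by
      refine Prod.ext ?_ ?_
      · simp only [deckZ, Vertex.toPlane, Prod.fst_add]
        rcases hx with ⟨hj, hx⟩ | ⟨hj, hx⟩
        · rw [if_pos hj]; exact hx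
        · rw [if_neg hj]; exact hx
      · simpa [deckZ, Vertex.toPlane] using hy
    refine ⟨(x, y) + (g * t, 0), ?_, by rw [← e, proj_deckZ, proj_toPlane]⟩
    simp only [List.mem_append] at hm ⊢
    rcases hm with ⟨(h' | h') | h', rfl⟩ | ⟨h', ht⟩
    · exact Or.inl (Or.inl (by simpa using h'))
    · exact Or.inl (Or.inr (by simpa using h.mem_nest_zero K h'))
    · exact Or.inr (by simpa using h')
    · exact Or.inl (Or.inr (h.mem_nest (by simpa only [List.mem_append] using h') K t ht))

theorem hasNullhomotopicTour_one_mod_zero (K m : ℕ) [NeZero m] (hm : m = 4 + 4 * K) :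
    HasNullhomotopicTour m 1 := by
  refine IsNest.hasNullhomotopicTour (a := (1, 3)) (b := (2, 1)) (g := 4)
    (A := [(1, 3), (3, 4)]) (B := [(4, 2), (2, 1)])
    (Z₁ := [(0, 0), (-1, 2)])
    (Z₂ := [])
    ⟨by decide, by decide, by decide, by decide, by decide⟩ (by decide) (by decide) (by decide) K
    (by simp; omega) (by omega) fun r hr c hc => ?_
  obtain ⟨q, s, hs, rfl⟩ : ∃ q s, s < 4 ∧ c = 4 * q + s := ⟨c / 4, c % 4, by omega, by omega⟩
  subst hm
  interval_cases r; interval_cases s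
  · by_cases hq0 : q = 0
    · exact ⟨0, 0, 0, .inl ⟨by decide, rfl⟩, 0, 0, by omega, .inl ⟨by decide, by omega⟩⟩
    exact ⟨4, 2, q - 1, .inr ⟨by decide, by omega⟩, 0, 2, by omega, .inl ⟨by decide, by omega⟩⟩
  -- Odd rows of the plane are read through the reflection, so there the columns decrease as the
  -- layers grow: hence `K - 1 - q`.
  · by_cases hq0 : q = K
    · exact ⟨2, 1, 0, .inl ⟨by decide, rfl⟩, 1, 1, by omega, .inr ⟨by decide, by omega⟩⟩
    exact ⟨6, 1, K - 1 - q, .inr ⟨by decide, by omega⟩, 1, 1, by omega, .inr ⟨by decide, by omega⟩⟩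
  · by_cases hq0 : q = K
    · exact ⟨1, 3, 0, .inl ⟨by decide, rfl⟩, 1, 3, by omega, .inr ⟨by decide, by omega⟩⟩
    exact ⟨5, 3, K - 1 - q, .inr ⟨by decide, by omega⟩, 1, 3, by omega, .inr ⟨by decide, by omega⟩⟩
  · by_cases hq0 : q = K
    · exact ⟨-1, 2, 0, .inl ⟨by decide, rfl⟩, -1, 2, by omega, .inl ⟨by decide, by omega⟩⟩
    exact ⟨3, 4, q, .inr ⟨by decide, by omega⟩, 0, 4, by omega, .inl ⟨by decide, by omega⟩⟩

theorem hasNullhomotopicTour_one_mod_two (K m : ℕ) [NeZero m] (hm : m = 6 + 4 * K) :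
    HasNullhomotopicTour m 1 := by
  refine IsNest.hasNullhomotopicTour (a := (0, 0)) (b := (1, 2)) (g := 4)
    (A := [(0, 0), (2, 1)]) (B := [(3, 3), (1, 2)])
    (Z₁ := [])
    (Z₂ := [(2, 4), (3, 2), (1, 3), (-1, 2)])
    ⟨by decide, by decide, by decide, by decide, by decide⟩ (by decide) (by decide) (by decide) K
    (by simp; omega) (by omega) fun r hr c hc => ?_
  obtain ⟨q, s, hs, rfl⟩ : ∃ q s, s < 4 ∧ c = 4 * q + s := ⟨c / 4, c % 4, by omega, by omega⟩
  subst hm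
  interval_cases r; interval_cases s
  · by_cases hq0 : q = 0
    · exact ⟨0, 0, 0, .inl ⟨by decide, rfl⟩, 0, 0, by omega, .inl ⟨by decide, by omega⟩⟩
    by_cases hq1 : q = K + 1
    · exact ⟨1, 3, 0, .inl ⟨by decide, rfl⟩, 1, 3, by omega, .inr ⟨by decide, by omega⟩⟩
    exact ⟨4, 0, q - 1, .inr ⟨by decide, by omega⟩, 0, 0, by omega, .inl ⟨by decide, by omega⟩⟩
  · by_cases hq0 : q = 0
    · exact ⟨1, 2, 0, .inl ⟨by decide, rfl⟩, 0, 2, by omega, .inl ⟨by decide, by omega⟩⟩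
    by_cases hq1 : q = K + 1
    · exact ⟨-1, 2, 0, .inl ⟨by decide, rfl⟩, -1, 2, by omega, .inl ⟨by decide, by omega⟩⟩
    exact ⟨5, 2, q - 1, .inr ⟨by decide, by omega⟩, 0, 2, by omega, .inl ⟨by decide, by omega⟩⟩
  · by_cases hq0 : q = 0
    · exact ⟨2, 4, 0, .inl ⟨by decide, rfl⟩, 0, 4, by omega, .inl ⟨by decide, by omega⟩⟩
    exact ⟨3, 3, K - q, .inr ⟨by decide, by omega⟩, 1, 3, by omega, .inr ⟨by decide, by omega⟩⟩
  · by_cases hq0 : q = 0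
    · exact ⟨3, 2, 0, .inl ⟨by decide, rfl⟩, 0, 2, by omega, .inl ⟨by decide, by omega⟩⟩
    exact ⟨2, 1, K - q, .inr ⟨by decide, by omega⟩, 1, 1, by omega, .inr ⟨by decide, by omega⟩⟩

theorem hasNullhomotopicTour_two_odd (K m : ℕ) [NeZero m] (hm : m = 3 + 2 * K) :
    HasNullhomotopicTour m 2 := by
  refine IsNest.hasNullhomotopicTour (a := (0, 2)) (b := (2, 1)) (g := 2)
    (A := [(0, 2), (1, 4)]) (B := [(3, 3), (2, 1)])
    (Z₁ := [(0, 0), (1, 2), (-1, 3), (-2, 1)])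
    (Z₂ := [])
    ⟨by decide, by decide, by decide, by decide, by decide⟩ (by decide) (by decide) (by decide) K
    (by simp; omega) (by omega) fun r hr c hc => ?_
  obtain ⟨q, s, hs, rfl⟩ : ∃ q s, s < 2 ∧ c = 2 * q + s := ⟨c / 2, c % 2, by omega, by omega⟩
  subst hm
  interval_cases r <;> interval_cases s
  · by_cases hq0 : q = 0
    · exact ⟨0, 0, 0, .inl ⟨by decide, rfl⟩, 0, 0, by omega, .inl ⟨by decide, by omega⟩⟩
    by_cases hq1 : q = K + 1
    · exact ⟨0, 2, 0, .inl ⟨by decide, rfl⟩, 1, 1, by omega, .inr ⟨by decide, by omega⟩⟩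
    exact ⟨2, 2, K - q, .inr ⟨by decide, by omega⟩, 1, 1, by omega, .inr ⟨by decide, by omega⟩⟩
  · by_cases hq0 : q = K
    · exact ⟨1, 2, 0, .inl ⟨by decide, rfl⟩, 1, 1, by omega, .inr ⟨by decide, by omega⟩⟩
    exact ⟨1, 4, q, .inr ⟨by decide, by omega⟩, 0, 2, by omega, .inl ⟨by decide, by omega⟩⟩
  · by_cases hq0 : q = 0
    · exact ⟨-1, 3, 0, .inl ⟨by decide, rfl⟩, 0, 1, by omega, .inr ⟨by decide, by omega⟩⟩
    by_cases hq1 : q = 1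
    · exact ⟨2, 1, 0, .inl ⟨by decide, rfl⟩, 0, 0, by omega, .inl ⟨by decide, by omega⟩⟩
    exact ⟨4, 1, q - 2, .inr ⟨by decide, by omega⟩, 0, 0, by omega, .inl ⟨by decide, by omega⟩⟩
  · by_cases hq0 : q = K
    · exact ⟨-2, 1, 0, .inl ⟨by decide, rfl⟩, -1, 0, by omega, .inl ⟨by decide, by omega⟩⟩
    exact ⟨3, 3, K - 1 - q, .inr ⟨by decide, by omega⟩, 1, 1, by omega, .inr ⟨by decide, by omega⟩⟩

theorem hasNullhomotopicTour_two_mod_zero (K m : ℕ) [NeZero m] (hm : m = 4 + 4 * K) :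
    HasNullhomotopicTour m 2 := by
  refine IsNest.hasNullhomotopicTour (a := (3, 3)) (b := (2, 1)) (g := 4)
    (A := [(3, 3), (5, 2)]) (B := [(8, 2), (9, 0), (7, 1), (6, -1), (4, 0), (2, 1)])
    (Z₁ := [(0, 0), (1, 2)])
    (Z₂ := [(4, 2), (5, 0), (3, 1), (2, -1)])
    ⟨by decide, by decide, by decide, by decide, by decide⟩ (by decide) (by decide) (by decide) K
    (by simp; omega) (by omega) fun r hr c hc => ?_
  obtain ⟨q, s, hs, rfl⟩ : ∃ q s, s < 4 ∧ c = 4 * q + s := ⟨c / 4, c % 4, by omega, by omega⟩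
  subst hm
  interval_cases r <;> interval_cases s
  · by_cases hq0 : q = 0
    · exact ⟨0, 0, 0, .inl ⟨by decide, rfl⟩, 0, 0, by omega, .inl ⟨by decide, by omega⟩⟩
    exact ⟨4, 0, q - 1, .inr ⟨by decide, by omega⟩, 0, 0, by omega, .inl ⟨by decide, by omega⟩⟩
  · by_cases hq0 : q = 1
    · exact ⟨5, 0, 0, .inl ⟨by decide, rfl⟩, 0, 0, by omega, .inl ⟨by decide, by omega⟩⟩
    -- Column 1 is represented by column `m + 1` of the plane, a square of the core if `K = 0` and
    -- of the last layer otherwise.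
    by_cases hq1 : q = 0 ∧ K = 0
    · exact ⟨5, 0, 0, .inl ⟨by decide, rfl⟩, 1, 0, by omega, .inl ⟨by decide, by omega⟩⟩
    by_cases hq2 : q = 0
    · exact ⟨9, 0, K - 1, .inr ⟨by decide, by omega⟩, 1, 0, by omega, .inl ⟨by decide, by omega⟩⟩
    exact ⟨9, 0, q - 2, .inr ⟨by decide, by omega⟩, 0, 0, by omega, .inl ⟨by decide, by omega⟩⟩
  · by_cases hq0 : q = K
    · exact ⟨1, 2, 0, .inl ⟨by decide, rfl⟩, 1, 1, by omega, .inr ⟨by decide, by omega⟩⟩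
    exact ⟨5, 2, K - 1 - q, .inr ⟨by decide, by omega⟩, 1, 1, by omega, .inr ⟨by decide, by omega⟩⟩
  · by_cases hq0 : q + 1 = K
    · exact ⟨4, 2, 0, .inl ⟨by decide, rfl⟩, 1, 1, by omega, .inr ⟨by decide, by omega⟩⟩
    -- Column `m - 1` is represented in plane row 2 by plane column `m`, with the same distinction.
    by_cases hq1 : q = K ∧ K = 0
    · exact ⟨4, 2, 0, .inl ⟨by decide, rfl⟩, 2, 1, by omega, .inr ⟨by decide, by omega⟩⟩
    by_cases hq2 : q = K
    · exact ⟨8, 2, K - 1, .inr ⟨by decide, by omega⟩, 2, 1, by omega, .inr ⟨by decide, by omega⟩⟩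
    exact ⟨8, 2, K - 2 - q, .inr ⟨by decide, by omega⟩, 1, 1, by omega, .inr ⟨by decide, by omega⟩⟩
  · by_cases hq0 : q = K
    · exact ⟨3, 3, 0, .inl ⟨by decide, rfl⟩, 1, 1, by omega, .inr ⟨by decide, by omega⟩⟩
    exact ⟨7, 3, K - 1 - q, .inr ⟨by decide, by omega⟩, 1, 1, by omega, .inr ⟨by decide, by omega⟩⟩
  · by_cases hq0 : q = K
    · exact ⟨2, -1, 0, .inl ⟨by decide, rfl⟩, 1, -1, by omega, .inr ⟨by decide, by omega⟩⟩
    exact ⟨6, -1, K - 1 - q, .inr ⟨by decide, by omega⟩, 1, -1, by omega, .inr ⟨by decide, by omega⟩⟩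
  · by_cases hq0 : q = 0
    · exact ⟨2, 1, 0, .inl ⟨by decide, rfl⟩, 0, 0, by omega, .inl ⟨by decide, by omega⟩⟩
    exact ⟨6, 1, q - 1, .inr ⟨by decide, by omega⟩, 0, 0, by omega, .inl ⟨by decide, by omega⟩⟩
  · by_cases hq0 : q = 0
    · exact ⟨3, 1, 0, .inl ⟨by decide, rfl⟩, 0, 0, by omega, .inl ⟨by decide, by omega⟩⟩
    exact ⟨7, 1, q - 1, .inr ⟨by decide, by omega⟩, 0, 0, by omega, .inl ⟨by decide, by omega⟩⟩

theorem hasNullhomotopicTour_two_mod_two (K m : ℕ) [NeZero m] (hm : m = 6 + 4 * K) :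
    HasNullhomotopicTour m 2 := by
  refine IsNest.hasNullhomotopicTour (a := (5, 4)) (b := (3, 3)) (g := 4)
    (A := [(5, 4), (6, 6), (4, 5), (6, 4), (8, 3), (7, 5)]) (B := [(5, 2), (3, 3)])
    (Z₁ := [(0, 0), (1, 2), (2, 4), (4, 3), (3, 5)])
    (Z₂ := [(1, 4), (-1, 5), (-3, 4), (-1, 3), (-2, 1)])
    ⟨by decide, by decide, by decide, by decide, by decide⟩ (by decide) (by decide) (by decide) K
    (by simp; omega) (by omega) fun r hr c hc => ?_
  obtain ⟨q, s, hs, rfl⟩ : ∃ q s, s < 4 ∧ c = 4 * q + s := ⟨c / 4, c % 4, by omega, by omega⟩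
  subst hm
  interval_cases r <;> interval_cases s
  · by_cases hq0 : q = 0
    · exact ⟨0, 0, 0, .inl ⟨by decide, rfl⟩, 0, 0, by omega, .inl ⟨by decide, by omega⟩⟩
    by_cases hq1 : q = K + 1
    · exact ⟨1, 2, 0, .inl ⟨by decide, rfl⟩, 1, 1, by omega, .inr ⟨by decide, by omega⟩⟩
    exact ⟨5, 2, K - q, .inr ⟨by decide, by omega⟩, 1, 1, by omega, .inr ⟨by decide, by omega⟩⟩
  · by_cases hq0 : q = 0
    · exact ⟨1, 4, 0, .inl ⟨by decide, rfl⟩, 0, 2, by omega, .inl ⟨by decide, by omega⟩⟩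
    by_cases hq1 : q = 1
    · exact ⟨5, 4, 0, .inl ⟨by decide, rfl⟩, 0, 2, by omega, .inl ⟨by decide, by omega⟩⟩
    exact ⟨9, 4, q - 2, .inr ⟨by decide, by omega⟩, 0, 2, by omega, .inl ⟨by decide, by omega⟩⟩
  · by_cases hq0 : q = 0
    · exact ⟨2, 4, 0, .inl ⟨by decide, rfl⟩, 0, 2, by omega, .inl ⟨by decide, by omega⟩⟩
    exact ⟨6, 4, q - 1, .inr ⟨by decide, by omega⟩, 0, 2, by omega, .inl ⟨by decide, by omega⟩⟩
  · by_cases hq0 : q = K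
    · exact ⟨-3, 4, 0, .inl ⟨by decide, rfl⟩, -1, 2, by omega, .inl ⟨by decide, by omega⟩⟩
    exact ⟨6, 6, K - 1 - q, .inr ⟨by decide, by omega⟩, 1, 3, by omega, .inr ⟨by decide, by omega⟩⟩
  · by_cases hq0 : q = 0
    · exact ⟨-1, 3, 0, .inl ⟨by decide, rfl⟩, 0, 1, by omega, .inr ⟨by decide, by omega⟩⟩
    by_cases hq1 : q = K + 1
    · exact ⟨-2, 1, 0, .inl ⟨by decide, rfl⟩, -1, 0, by omega, .inl ⟨by decide, by omega⟩⟩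
    exact ⟨4, 5, q - 1, .inr ⟨by decide, by omega⟩, 0, 2, by omega, .inl ⟨by decide, by omega⟩⟩
  · by_cases hq0 : q = K + 1
    · exact ⟨-1, 5, 0, .inl ⟨by decide, rfl⟩, -1, 2, by omega, .inl ⟨by decide, by omega⟩⟩
    by_cases hq1 : q = K
    · exact ⟨4, 3, 0, .inl ⟨by decide, rfl⟩, 1, 1, by omega, .inr ⟨by decide, by omega⟩⟩
    exact ⟨8, 3, K - 1 - q, .inr ⟨by decide, by omega⟩, 1, 1, by omega, .inr ⟨by decide, by omega⟩⟩
  · by_cases hq0 : q = K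
    · exact ⟨3, 3, 0, .inl ⟨by decide, rfl⟩, 1, 1, by omega, .inr ⟨by decide, by omega⟩⟩
    exact ⟨7, 3, K - 1 - q, .inr ⟨by decide, by omega⟩, 1, 1, by omega, .inr ⟨by decide, by omega⟩⟩
  · by_cases hq0 : q = 0
    · exact ⟨3, 5, 0, .inl ⟨by decide, rfl⟩, 0, 2, by omega, .inl ⟨by decide, by omega⟩⟩
    exact ⟨7, 5, q - 1, .inr ⟨by decide, by omega⟩, 0, 2, by omega, .inl ⟨by decide, by omega⟩⟩

/-! ### All boards -/

theorem hasStrip_of_band {k : ℕ} {x y : ℤ} {s : ℕ → ℤ} {m : ℕ} (hm : 0 < m)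
    (h : ∃ l, Band k x y l ∧ HasRows 1 k s m l) : HasStrip k m := by
  obtain ⟨l, hl, hr⟩ := h
  exact .of_hasRows_one hm hl hr

theorem hasStrip_of_band_two {k : ℕ} {x y : ℤ} {s : ℕ → ℤ} {m : ℕ} (hm : Odd m)
    (h : ∃ l, Band k x y l ∧ HasRows 2 k s m l) : HasStrip k m := by
  obtain ⟨l, hl, hr⟩ := h
  exact .of_hasRows_two hm hl hr

/-- An even positive number is `2`, or at least `4` and of one of two forms. -/
theorem even_cases {m : ℕ} (hm : Even m) (h0 : 0 < m) :
    m = 2 ∨ (∃ K, m = 4 + 4 * K) ∨ ∃ K, m = 6 + 4 * K := by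
  obtain ⟨q, rfl⟩ := hm
  rcases Nat.even_or_odd' q with ⟨u, rfl | rfl⟩
  · exact Or.inr (Or.inl ⟨u - 1, by omega⟩)
  · by_cases hu : u = 0
    · exact Or.inl (by omega)
    · exact Or.inr (Or.inr ⟨u - 1, by omega⟩)

theorem hasStrip_three {m : ℕ} (hm : Even m) (h0 : 0 < m) : HasStrip 3 m := by
  rcases even_cases hm h0 with rfl | ⟨K, rfl⟩ | ⟨K, rfl⟩
  · exact hasStrip_three_two
  · exact hasStrip_of_band h0 (exists_band_three_four K)
  · exact hasStrip_of_band h0 (exists_band_three_six K)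

theorem hasStrip_five {m : ℕ} (hm : Even m) (h0 : 0 < m) : HasStrip 5 m := by
  rcases even_cases hm h0 with rfl | ⟨K, rfl⟩ | ⟨K, rfl⟩
  · exact hasStrip_five_two
  · exact hasStrip_of_band h0 (exists_band_five_four K)
  · exact hasStrip_of_band h0 (exists_band_five_six K)

theorem hasStrip_seven {m : ℕ} (hm : Even m) (h0 : 0 < m) : HasStrip 7 m := by
  rcases even_cases hm h0 with rfl | ⟨K, rfl⟩ | ⟨K, rfl⟩
  · exact hasStrip_seven_two
  · exact hasStrip_of_band h0 (exists_band_seven_four K)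
  · exact hasStrip_of_band h0 (exists_band_seven_six K)

/-- Rows are added three at a time. Height 7 needs a band of its own because `7 - 3 = 4` is missing.
-/
theorem hasStrip_of_even {m : ℕ} (hm : Even m) (h0 : 0 < m) (n : ℕ) (hn : 3 ≤ n) (h4 : n ≠ 4) :
    HasStrip n m := by
  induction n using Nat.strong_induction_on with
  | _ n ih =>
    by_cases h3 : n = 3
    · exact h3 ▸ hasStrip_three hm h0
    by_cases h5 : n = 5
    · exact h5 ▸ hasStrip_five hm h0
    by_cases h7 : n = 7
    · exact h7 ▸ hasStrip_seven hm h0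
    have h := (ih (n - 3) (by omega) (by omega) (by omega)).add (hasStrip_three hm h0)
    rwa [Nat.sub_add_cancel hn] at h

theorem hasStrip_four_of_odd {m : ℕ} (hm : Odd m) : HasStrip 4 m := by
  obtain ⟨K, rfl⟩ := hm
  rw [add_comm] at *
  exact hasStrip_of_band_two ⟨K, by ring⟩ (exists_band_four_one K)

theorem hasStrip_six_of_odd {m : ℕ} (hm : Odd m) : HasStrip 6 m := by
  obtain ⟨K, rfl⟩ := hm
  rw [add_comm] at *
  exact hasStrip_of_band_two ⟨K, by ring⟩ (exists_band_six_one K)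

theorem hasStrip_of_odd {m : ℕ} (hm : Odd m) (k : ℕ) : HasStrip (2 * k + 4) m := by
  induction k using Nat.strong_induction_on with
  | _ k ih =>
    by_cases h0 : k = 0
    · exact h0 ▸ hasStrip_four_of_odd hm
    by_cases h1 : k = 1
    · exact h1 ▸ hasStrip_six_of_odd hm
    have h := (ih (k - 2) (by omega)).add (hasStrip_four_of_odd hm)
    have e : 2 * (k - 2) + 4 + 4 = 2 * k + 4 := by omega
    rwa [e] at h

/-- Four rows of half the width of the board, of one colour, and a copy of them across the twisted
side make up a tour of the board of height four. -/
theorem hasNullhomotopicTour_four_of_band {h : ℕ} {x y : ℤ} {s : ℕ → ℤ} {l : List (ℤ × ℤ)}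
    [NeZero (2 * h)] (hb : Band 4 x y l) (hr : HasRows 2 4 s h l) (hx : x % 2 = 1)
    (hy : y % 2 = 0) : HasNullhomotopicTour (2 * h) 4 := by
  have h0 : 0 < h := by have := NeZero.ne (2 * h); omega
  have h0' : (0 : ℤ) < h := by exact_mod_cast h0
  obtain ⟨l', hp, hloop⟩ := (hb.append hb).exists_isLoop
  refine hasNullhomotopicTour_of_isLoop (2 * h) 4 l' hloop ?_ (by omega) fun v => ?_
  · rw [← hp.length_eq]
    simp [hr.1]
    ring
  · have key : ∀ u : ℤ, ∃ i : ℤ, (s v.2 + 2 * u - 2 * h * i, ((v.2 : ℕ) : ℤ)) ∈ l := by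
      intro u
      have h1 := Int.emod_nonneg u h0'.ne'
      have h2 := Int.emod_lt_of_pos u h0'
      have h3 := Int.emod_def u h
      have := hr.2 v.2 v.2.2 (u % h).toNat (by omega)
      refine ⟨u / h, ?_⟩
      convert! this using 2
      rw [Int.toNat_of_nonneg h1, h3]
      ring
    have hmem : ∀ i j : ℤ, deckZ (2 * h) 4 i j v.toPlane ∈
        l ++ l.map (· + (x + 1 - y, 4)) → ∃ p ∈ l', proj (2 * h) 4 p = v := fun i j hm =>
      ⟨_, hp.mem_iff.mp hm, by rw [proj_deckZ, proj_toPlane]⟩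
    -- The column parity decides which copy contains the vertex: `c ↦ -1 - c` exchanges the
    -- parities, while the shift `x + 1 - y` and the width are even.
    rcases Int.emod_two_eq_zero_or_one ((v.1 : ℕ) - s v.2) with hs | hs
    · obtain ⟨i, hi⟩ := key (((v.1 : ℕ) - s v.2) / 2)
      refine hmem (-i) 0 (List.mem_append_left _ ?_)
      convert! hi using 1
      refine Prod.ext ?_ (by simp [deckZ, Vertex.toPlane])
      have : 2 * ((((v.1 : ℕ) : ℤ) - s v.2) / 2) = (v.1 : ℕ) - s v.2 := by omega
      simp only [deckZ, Vertex.toPlane, Even.zero, if_true, this]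
      push_cast
      ring
    · obtain ⟨i, hi⟩ := key ((-1 - (v.1 : ℕ) - (x + 1 - y) - s v.2) / 2)
      refine hmem (-i) 1 (List.mem_append_right _ (List.mem_map.mpr ⟨_, hi, ?_⟩))
      have : 2 * ((-1 - ((v.1 : ℕ) : ℤ) - (x + 1 - y) - s v.2) / 2) =
          -1 - (v.1 : ℕ) - (x + 1 - y) - s v.2 := by omega
      refine Prod.ext ?_ (by simp [deckZ, Vertex.toPlane])
      simp only [deckZ, Vertex.toPlane, Int.not_even_one, if_false, this, Prod.fst_add]
      push_cast
      ring

theorem hasNullhomotopicTour_four_of_even {m : ℕ} [NeZero m] (hm : Even m) :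
    HasNullhomotopicTour m 4 := by
  obtain ⟨h, hh⟩ := hm
  obtain rfl : m = 2 * h := by omega
  have h0 := NeZero.ne (2 * h)
  rcases Nat.even_or_odd' h with ⟨K, hK | hK⟩
  · obtain ⟨l, hl, hr⟩ := exists_band_four_two (K - 1)
    rw [show 2 + 2 * (K - 1) = h by omega] at hr
    exact hasNullhomotopicTour_four_of_band hl hr (by decide) (by decide)
  · obtain ⟨l, hl, hr⟩ := exists_band_four_one K
    rw [show 1 + 2 * K = h by omega] at hr
    exact hasNullhomotopicTour_four_of_band hl hr (by decide) (by decide)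

theorem hasNullhomotopicTour_one_one : HasNullhomotopicTour 1 1 :=
  ⟨.nil _, ⟨by simp [Walk.edges], by simp [Walk.starts], fun u => Or.inl (Subsingleton.elim _ _)⟩,
    (Walk.isNullhomotopic_iff_liftEnd _ (0, 0) (proj_zero 1 1)).mpr rfl⟩

theorem hasNullhomotopicTour_of_even {m n : ℕ} [NeZero m] [NeZero n] (hm : Even m)
    (h : 2 < m ∨ 2 < n) : HasNullhomotopicTour m n := by
  have hm0 := NeZero.pos m
  have hn0 := NeZero.pos n
  by_cases h4 : n = 4
  · subst h4
    exact hasNullhomotopicTour_four_of_even hm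
  by_cases hn : 3 ≤ n
  · exact (hasStrip_of_even hm hm0 n hn h4).hasNullhomotopicTour (by nlinarith)
  rcases even_cases hm hm0 with h2 | ⟨K, hK⟩ | ⟨K, hK⟩
  · omega
  · interval_cases n
    · exact hasNullhomotopicTour_one_mod_zero K m hK
    · exact hasNullhomotopicTour_two_mod_zero K m hK
  · interval_cases n
    · exact hasNullhomotopicTour_one_mod_two K m hK
    · exact hasNullhomotopicTour_two_mod_two K m hK

theorem hasNullhomotopicTour_of_odd {m n : ℕ} [NeZero m] [NeZero n] (hm : Odd m) (hn : Even n)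
    (h : 2 < m ∨ 2 < n) : HasNullhomotopicTour m n := by
  have hm0 := NeZero.pos m
  have hn0 := NeZero.pos n
  obtain ⟨k, rfl⟩ := even_iff_two_dvd.mp hn
  by_cases hk : k = 1
  · subst hk
    obtain ⟨K, hK⟩ := hm
    exact hasNullhomotopicTour_two_odd (K - 1) m (by omega)
  · have hs := hasStrip_of_odd hm (k - 2)
    rw [show 2 * (k - 2) + 4 = 2 * k by omega] at hs
    exact hs.hasNullhomotopicTour (by nlinarith [show 2 ≤ k by omega])

end KleinKnight

/-! ### The classification -/

theorem theorem6p1 (m n : ℕ) [NeZero m] [NeZero n] :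
    KleinKnight.HasNullhomotopicTour m n ↔
      ¬ (Odd m ∧ Odd n ∧ (1 < m ∨ 1 < n)) ∧ ¬ (m ≤ 2 ∧ n ≤ 2 ∧ (1 < m ∨ 1 < n)) := by
  have hm0 := NeZero.pos m
  have hn0 := NeZero.pos n
  constructor
  · refine fun h => ⟨fun ⟨hm, hn, h1⟩ => ?_, fun ⟨hm, hn, h1⟩ => ?_⟩
    · exact KleinKnight.not_hasNullhomotopicTour_of_odd hm hn
        (h1.elim (fun h => by nlinarith) fun h => by nlinarith) h
    · by_cases h4 : m = 2 ∧ n = 2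
      · obtain ⟨rfl, rfl⟩ := h4
        exact KleinKnight.not_hasNullhomotopicTour_two_two h
      -- The boards left are 1 × 2 and 2 × 1.
      · refine KleinKnight.not_hasNullhomotopicTour_of_two ?_ h
        interval_cases m <;> interval_cases n <;> simp_all
  · rintro ⟨h1, h2⟩
    by_cases h0 : m = 1 ∧ n = 1
    · obtain ⟨rfl, rfl⟩ := h0
      exact KleinKnight.hasNullhomotopicTour_one_one
    rcases Nat.even_or_odd m with hm | hm
    · exact KleinKnight.hasNullhomotopicTour_of_even hm (by omega)
    · rcases Nat.even_or_odd n with hn | hn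
      · exact KleinKnight.hasNullhomotopicTour_of_odd hm hn (by omega)
      · exact absurd ⟨hm, hn, by omega⟩ h1
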